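/- Let $R$ be a commutative ring. By an algebra we mean a commutative, associative, not necessarily unital $R$-algebra. A divided power (DP) algebra is an algebra $A$ with operations $\gamma_n:A\to A$, $n>0$, such that for all $a,b\in A$, $r\in R$ and $m,n>0$: $\gamma_1(a)=a$; $\gamma_n(a+b)=\gamma_n(a)+\sum_{i+j=n,\ i,j>0}\gamma_i(a)\gamma_j(b)+\gamma_n(b)$; $\gamma_n(ab)=a^n\gamma_n(b)$; $\gamma_n(ra)=r^n\gamma_n(a)$; $\gamma_m(a)\gamma_n(a)=\frac{(m+n)!}{m!\,n!}\gamma_{m+n}(a)$; $\gamma_m(\gamma_n(a))=\frac{(mn)!}{m!\,(n!)^m}\gamma_{mn}(a)$. A DP map is an algebra map commuting with all $\gamma_n$. Fix a DP algebra $A$ and put $A_+=R\oplus A$, the algebra with a unit adjoined. A DP $A$-module (Beck module) is an abelian group object $E\to A$ in the category of DP algebras over $A$. A DP $A$-module structure on an $A_+$-module $M$ is a structure of such an abelian group object on the square-zero extension $A\oplus M\to A$, with product $(a,x)(b,y)=(ab,ay+bx)$ and zero section $a\mapsto(a,0)$. A map $s:A\to M$ is then a DP derivation if $a\mapsto(a,s(a))$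 is a DP map $A\to A\oplus M$. Let $U(A)$ be the ring generated over $A_+$ by symbols $\varphi_p$ ($p$ prime) with the relations $p\varphi_p=0$, $\varphi_p r=r^p\varphi_p$ for $r\in R$, and $\varphi_p a=0$ for $a\in A$. In $U(A)$ put $\varphi_1=1$, $\varphi_{p^e}=\varphi_p^e$ for $p$ prime and $e\geq 1$, and $\varphi_n=0$ if $n$ is not a prime power and $n\neq 1$. A DP derivation $s$ from $A$ into a left $U(A)$-module $M$ is an $R$-linear map with $s(ab)=a\,s(b)+b\,s(a)$ and $s(\gamma_n a)=\varphi_n s(a)+\sum_{i+j=n,\ i,j>0}\gamma_i(a)\varphi_j s(a)$ for all $n>0$. Let $d:A\to\Omega^{CA}_{A/R}$ be the universal $R$-linear derivation of the commutative algebra $A$; thus $\Omega^{CA}_{A/R}=\Omega_{A_+/R}$, an $A_+$-module, and $d$ is the restriction to $A$ of the universal derivation of $A_+$. **Theorem.** Let $A$ be a DP algebra over an arbitrary commutative ring $R$. (1) There is a unique DP $A$-module structure on the $A_+$-module $\Omega^{CA}_{A/R}$ for which $d$ is a DP derivation. (2) With this structure $d$ is the universal DP derivation: for every abelian group object $E\to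 A$ in the category of DP algebras over $A$ and every DP map $t:A\to E$ that is a section of $E\to A$, there is exactly one homomorphism $F:A\oplus\Omega^{CA}_{A/R}\to E$ of abelian group objects over $A$ with $F(a,da)=t(a)$ for all $a\in A$. That is, $\Omega^{DP}_{A/R}=\Omega^{CA}_{A/R}$. (3) Equivalently, in terms of $U(A)$-modules: there is a unique left $U(A)$-module structure on $\Omega^{CA}_{A/R}$ that extends its $A_+$-module structure and for which $d$ is a DP derivation; and with it, every DP derivation $t:A\to N$ into a left $U(A)$-module $N$ is $t=f\circ d$ for exactly one $U(A)$-linear map $f:\Omega^{CA}_{A/R}\to N$. The two structures correspond: the divided powers of $A\oplus\Omega^{CA}_{A/R}$ in (1) are $$\gamma_n(a,x)=\Big(\gamma_n a,\ \varphi_n x+\sum_{i+j=n,\ i,j>0}\gamma_i(a)\varphi_j x\Big),\qquad n>0.$$ -/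

import Mathlib

/-!  Divided power (DP) algebras, in the non-unital setting: throughout, "algebra" means a commutative
non-unital associative algebra over a commutative ring `R`. -/

namespace DPKaehler

universe u v w t

section DPAlgebras

variable (R : Type u) [CommRing R]

/-- A DP structure on the (commutative, non-unital) `R`-algebra `A`: operations `γ n : A → A` for
`n > 0`. The operation of index `0` carries no information; it is normalised to be zero, so that two DP
structures with the same operations `γ n`, `n > 0`, are equal.
The element `a ^ n * γ n b` is written as the `n`-fold iterate of multiplication by `a` applied to
`γ n b`, since `A` has no unit. -/
@[ext]
structure DPStructure (A : Type v) [NonUnitalCommRing A] [Module R A] where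
  /-- the divided power operations -/
  dpow : ℕ → A → A
  dpow_index_zero : ∀ a, dpow 0 a = 0
  dpow_one : ∀ a, dpow 1 a = a
  dpow_add : ∀ n, 0 < n → ∀ a b,
    dpow n (a + b) = dpow n a + ∑ i ∈ Finset.Ioo 0 n, dpow i a * dpow (n - i) b + dpow n b
  dpow_mul : ∀ n, 0 < n → ∀ a b, dpow n (a * b) = (fun x => a * x)^[n] (dpow n b)
  dpow_smul : ∀ n, 0 < n → ∀ (r : R) a, dpow n (r • a) = r ^ n • dpow n a
  mul_dpow : ∀ m n, 0 < m → 0 < n → ∀ a,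
    dpow m a * dpow n a =
      ((m + n).factorial / (m.factorial * n.factorial)) • dpow (m + n) a
  dpow_comp : ∀ m n, 0 < m → 0 < n → ∀ a,
    dpow m (dpow n a) =
      ((m * n).factorial / (m.factorial * n.factorial ^ m)) • dpow (m * n) a

variable {R}

/-- An algebra map is a morphism of DP algebras if it commutes with the divided powers. -/
def IsDPHom {A : Type v} [NonUnitalCommRing A] [Module R A]
    {B : Type w} [NonUnitalCommRing B] [Module R B]
    (γ : DPStructure R A) (δ : DPStructure R B) (f : A →ₙₐ[R] B) : Prop :=
  ∀ n a, f (γ.dpow n a) = δ.dpow n (f a)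

end DPAlgebras

section AbelianObjects

variable {R : Type u} [CommRing R]
  {A : Type v} [NonUnitalCommRing A] [Module R A]
  {E : Type w} [NonUnitalCommRing E] [Module R E]

/-- The fibre product `E ×_A E` of `π : E → A` with itself, a subalgebra of `E × E`. -/
def fibreProd (π : E →ₙₐ[R] A) : NonUnitalSubalgebra R (E × E) where
  carrier := {x | π x.1 = π x.2}
  add_mem' := by
    intro x y hx hy
    simp only [Set.mem_ofPred_eq, Prod.fst_add, Prod.snd_add, map_add] at *
    rw [hx, hy]
  zero_mem' := by simp
  mul_mem' := by
    intro x y hx hy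
    simp only [Set.mem_ofPred_eq, Prod.fst_mul, Prod.snd_mul, map_mul] at *
    rw [hx, hy]
  smul_mem' := by
    intro r x hx
    simp only [Set.mem_ofPred_eq, Prod.smul_fst, Prod.smul_snd, map_smul] at *
    rw [hx]

/-- The componentwise DP structure on `E ×_A E`; it is the product of `E → A` with itself in the
category of DP algebras over `A`. -/
def fibreProdDP {γ : DPStructure R A} (ε : DPStructure R E) (π : E →ₙₐ[R] A)
    (hπ : IsDPHom ε γ π) : DPStructure R (fibreProd π) where
  dpow n x := ⟨(ε.dpow n x.1.1, ε.dpow n x.1.2), by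
    have hx : π x.1.1 = π x.1.2 := x.2
    change π (ε.dpow n x.1.1) = π (ε.dpow n x.1.2)
    rw [hπ, hπ, hx]⟩
  dpow_index_zero x := by
    ext <;> simp [ε.dpow_index_zero]
  dpow_one x := by
    ext <;> simp [ε.dpow_one]
  dpow_add n hn x y := by
    ext
    · simp [ε.dpow_add n hn, Prod.fst_sum]
    · simp [ε.dpow_add n hn, Prod.snd_sum]
  dpow_mul n hn x y := by
    have key : ∀ (k : ℕ) (z : fibreProd π),
        ((fun t => x * t)^[k] z).1 =
          ((fun t => x.1.1 * t)^[k] z.1.1, (fun t => x.1.2 * t)^[k] z.1.2) := by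
      intro k
      induction k with
      | zero => intro z; rfl
      | succ k ih =>
        intro z
        rw [Function.iterate_succ_apply, Function.iterate_succ_apply, Function.iterate_succ_apply, ih]
        rfl
    apply Subtype.ext
    rw [key]
    exact Prod.ext (ε.dpow_mul n hn _ _) (ε.dpow_mul n hn _ _)
  dpow_smul n hn r x := by
    ext
    · simp [ε.dpow_smul n hn]
    · simp [ε.dpow_smul n hn]
  mul_dpow m n hm hn x := by
    ext
    · simpa using ε.mul_dpow m n hm hn x.1.1
    · simpa using ε.mul_dpow m n hm hn x.1.2
  dpow_comp m n hm hn x := by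
    ext
    · simpa using ε.dpow_comp m n hm hn x.1.1
    · simpa using ε.dpow_comp m n hm hn x.1.2

/-- The structure of an abelian group object, in the category of DP algebras over the DP algebra
`(A, γ)`, on the object `π : (E, ε) → (A, γ)`. The terminal object of that category is `A` itself and
products are fibre products over `A`. -/
@[ext]
structure AbelianObject (γ : DPStructure R A) (ε : DPStructure R E) (π : E →ₙₐ[R] A) where
  /-- the structure map is a DP map -/
  isDPHom_proj : IsDPHom ε γ π
  /-- the neutral element `A → E` -/
  zero : A →ₙₐ[R] E
  isDPHom_zero : IsDPHom γ ε zero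
  proj_zero : ∀ a, π (zero a) = a
  /-- the inversion `E → E` -/
  neg : E →ₙₐ[R] E
  isDPHom_neg : IsDPHom ε ε neg
  proj_neg : ∀ e, π (neg e) = π e
  /-- the group law `E ×_A E → E` -/
  add : fibreProd π →ₙₐ[R] E
  isDPHom_add : IsDPHom (fibreProdDP ε π isDPHom_proj) ε add
  proj_add : ∀ x, π (add x) = π x.1.1
  zero_add : ∀ e, add ⟨(zero (π e), e), proj_zero (π e)⟩ = e
  neg_add_cancel : ∀ e, add ⟨(neg e, e), proj_neg e⟩ = zero (π e)
  add_comm : ∀ e f (h : π e = π f), add ⟨(e, f), h⟩ = add ⟨(f, e), h.symm⟩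
  add_assoc : ∀ e f g (h : π e = π f) (k : π f = π g),
    add ⟨(add ⟨(e, f), h⟩, g), (proj_add ⟨(e, f), h⟩).trans (h.trans k)⟩ =
      add ⟨(e, add ⟨(f, g), k⟩), h.trans (proj_add ⟨(f, g), k⟩).symm⟩

/-- Homomorphisms of abelian group objects over `A`: DP algebra maps over `A` that respect the
group laws. -/
structure AbelianObject.IsHom {E' : Type*} [NonUnitalCommRing E'] [Module R E']
    {γ : DPStructure R A} {ε : DPStructure R E} {π : E →ₙₐ[R] A}
    {ε' : DPStructure R E'} {π' : E' →ₙₐ[R] A}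
    (α : AbelianObject γ ε π) (β : AbelianObject γ ε' π') (F : E →ₙₐ[R] E') : Prop where
  isDPHom : IsDPHom ε ε' F
  proj_apply : ∀ e, π' (F e) = π e
  map_add : ∀ e f (h : π e = π f),
    F (α.add ⟨(e, f), h⟩) =
      β.add ⟨(F e, F f), (proj_apply e).trans (h.trans (proj_apply f).symm)⟩

end AbelianObjects

section SquareZero

/-- The square-zero extension `A ⊕ M` of `A` by the module `M` over the unital algebra
`A₊ = R ⊕ A` (Mathlib's `Unitization R A`), with product
`(a, x) (b, y) = (a b, a y + b x)` (defined below). -/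
@[ext]
structure SqZero (R : Type u) (A : Type v) (M : Type w) where
  /-- the component in `A` -/
  fst : A
  /-- the component in `M` -/
  snd : M

variable (R : Type u) [CommRing R]
  (A : Type v) [NonUnitalCommRing A] [Module R A] [IsScalarTower R A A] [SMulCommClass R A A]
  (M : Type w) [AddCommGroup M] [Module (Unitization R A) M]

namespace SqZero

variable {R A M}

instance : Zero (SqZero R A M) := ⟨⟨0, 0⟩⟩
instance : Add (SqZero R A M) := ⟨fun x y => ⟨x.fst + y.fst, x.snd + y.snd⟩⟩
instance : Neg (SqZero R A M) := ⟨fun x => ⟨-x.fst, -x.snd⟩⟩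
instance : Mul (SqZero R A M) :=
  ⟨fun x y => ⟨x.fst * y.fst, (x.fst : Unitization R A) • y.snd + (y.fst : Unitization R A) • x.snd⟩⟩
instance : SMul R (SqZero R A M) :=
  ⟨fun r x => ⟨r • x.fst, (Unitization.inl r : Unitization R A) • x.snd⟩⟩

set_option linter.unusedSectionVars false

@[simp] theorem fst_zero : (0 : SqZero R A M).fst = 0 := rfl
@[simp] theorem snd_zero : (0 : SqZero R A M).snd = 0 := rfl
@[simp] theorem fst_add (x y : SqZero R A M) : (x + y).fst = x.fst + y.fst := rfl
@[simp] theorem snd_add (x y : SqZero R A M) : (x + y).snd = x.snd + y.snd := rfl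
@[simp] theorem fst_neg (x : SqZero R A M) : (-x).fst = -x.fst := rfl
@[simp] theorem snd_neg (x : SqZero R A M) : (-x).snd = -x.snd := rfl
@[simp] theorem fst_mul (x y : SqZero R A M) : (x * y).fst = x.fst * y.fst := rfl
@[simp] theorem snd_mul (x y : SqZero R A M) : (x * y).snd =
    (x.fst : Unitization R A) • y.snd + (y.fst : Unitization R A) • x.snd := rfl
@[simp] theorem fst_smul (r : R) (x : SqZero R A M) : (r • x).fst = r • x.fst := rfl
@[simp] theorem snd_smul (r : R) (x : SqZero R A M) :
    (r • x).snd = (Unitization.inl r : Unitization R A) • x.snd := rfl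

instance : NonUnitalCommRing (SqZero R A M) where
  add_assoc x y z := by ext <;> simp [add_assoc]
  zero_add x := by ext <;> simp
  add_zero x := by ext <;> simp
  add_comm x y := by ext <;> simp [add_comm]
  neg_add_cancel x := by ext <;> simp
  nsmul := nsmulRec
  zsmul := zsmulRec
  left_distrib x y z := by
    ext
    · simp [mul_add]
    · simp [add_smul]; abel
  right_distrib x y z := by
    ext
    · simp [add_mul]
    · simp [add_smul]; abel
  zero_mul x := by ext <;> simp
  mul_zero x := by ext <;> simp
  mul_assoc x y z := by
    ext
    · simp [mul_assoc]
    · simp only [snd_mul, fst_mul, smul_add, smul_smul, Unitization.inr_mul]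
      rw [mul_comm (z.fst : Unitization R A) (x.fst : Unitization R A),
        mul_comm (z.fst : Unitization R A) (y.fst : Unitization R A), add_assoc]
  mul_comm x y := by
    ext
    · simp [mul_comm]
    · simp [add_comm]

instance : Module R (SqZero R A M) where
  one_smul x := by ext <;> simp
  mul_smul r s x := by ext <;> simp [mul_smul]
  smul_zero r := by ext <;> simp
  smul_add r x y := by ext <;> simp
  add_smul r s x := by ext <;> simp [add_smul]
  zero_smul x := by ext <;> simp

instance : IsScalarTower R (SqZero R A M) (SqZero R A M) where
  smul_assoc r x y := by
    have h : ∀ a : A, ((r • a : A) : Unitization R A) = Unitization.inl r * (a : Unitization R A) :=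
      fun a => (Unitization.inl_mul_inr r a).symm
    change (r • x) * y = r • (x * y)
    ext
    · exact smul_mul_assoc r x.fst y.fst
    · simp only [snd_mul, fst_smul, snd_smul, smul_add, smul_smul, h]
      rw [mul_comm (y.fst : Unitization R A) (Unitization.inl r)]

instance : SMulCommClass R (SqZero R A M) (SqZero R A M) where
  smul_comm r x y := by
    change r • (x * y) = x * (r • y)
    rw [mul_comm x y, mul_comm x (r • y)]
    exact (smul_assoc r y x).symm

variable (R A M)

/-- The projection `A ⊕ M → A`. -/
def proj : SqZero R A M →ₙₐ[R] A where
  toFun := fst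
  map_smul' _ _ := rfl
  map_zero' := rfl
  map_add' _ _ := rfl
  map_mul' _ _ := rfl

end SqZero

variable {R A}

/-- A DP `A`-module (Beck module) structure on an `A₊`-module `M`: a DP structure on the algebra
`A ⊕ M` together with a structure of abelian group object over `A` on `A ⊕ M → A`, with neutral element
`a ↦ (a, 0)`. The kernel of the projection is then `M`, with its given `A₊`-module structure. -/
@[ext]
structure DPModuleStructure (γ : DPStructure R A) where
  /-- the divided powers of `A ⊕ M` -/
  dp : DPStructure R (SqZero R A M)
  /-- the group structure of `A ⊕ M → A` -/
  abelian : AbelianObject γ dp (SqZero.proj R A M)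
  zero_apply : ∀ a, abelian.zero a = ⟨a, 0⟩

variable {M}

/-- `s : A → M` is a DP derivation if `a ↦ (a, s a)` is a DP algebra map `A → A ⊕ M` (it is
automatically a section of the projection, and `s` is automatically `R`-linear). -/
def DPModuleStructure.IsDPDerivation {γ : DPStructure R A} (σ : DPModuleStructure M γ)
    (s : A → M) : Prop :=
  ∃ t : A →ₙₐ[R] SqZero R A M, IsDPHom γ σ.dp t ∧ ∀ a, t a = ⟨a, s a⟩

/-- `s : A → M` is the universal DP derivation: sections `t` of abelian objects `E → A` in the category
of DP algebras over `A` are, uniquely, images of the section `a ↦ (a, s a)` of `A ⊕ M` under a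
homomorphism of abelian objects over `A`. -/
def DPModuleStructure.IsUniversal {γ : DPStructure R A} (σ : DPModuleStructure M γ)
    (s : A → M) : Prop :=
  ∀ (E : Type t) [NonUnitalCommRing E] [Module R E] [IsScalarTower R E E] [SMulCommClass R E E]
    (ε : DPStructure R E) (π : E →ₙₐ[R] A) (β : AbelianObject γ ε π)
    (t : A →ₙₐ[R] E), IsDPHom γ ε t → (∀ a, π (t a) = a) →
    ∃! F : SqZero R A M →ₙₐ[R] E, σ.abelian.IsHom β F ∧ ∀ a, F ⟨a, s a⟩ = t a

end SquareZero

section Enveloping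

variable (R : Type u) [CommRing R]
  (A : Type v) [NonUnitalCommRing A] [Module R A] [IsScalarTower R A A] [SMulCommClass R A A]

/-- Generators of the universal enveloping algebra: an element of `A₊` or a symbol `φ_p`. -/
abbrev UPre := FreeAlgebra ℤ (Unitization R A ⊕ Nat.Primes)

variable {R A}

/-- The generator of `UPre R A` given by an element of `A₊`. -/
def UPre.of (x : Unitization R A) : UPre R A := FreeAlgebra.ι ℤ (Sum.inl x)

variable (R A)

/-- The generator `φ_p` of `UPre R A`. -/
def UPre.phi (p : Nat.Primes) : UPre R A := FreeAlgebra.ι ℤ (Sum.inr p)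

/-- The defining relations of `U(A)`: `A₊ → U(A)` is a ring map, `p φ_p = 0`, `φ_p r = r ^ p φ_p` for
`r ∈ R` and `φ_p a = 0` for `a ∈ A`. -/
inductive URel : UPre R A → UPre R A → Prop
  | one : URel (UPre.of 1) 1
  | add (x y : Unitization R A) : URel (UPre.of (x + y)) (UPre.of x + UPre.of y)
  | mul (x y : Unitization R A) : URel (UPre.of (x * y)) (UPre.of x * UPre.of y)
  | prime_mul_phi (p : Nat.Primes) : URel (((p : ℕ) : UPre R A) * UPre.phi R A p) 0
  | phi_mul_scalar (p : Nat.Primes) (r : R) :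
      URel (UPre.phi R A p * UPre.of (Unitization.inl r))
        (UPre.of (Unitization.inl (r ^ (p : ℕ))) * UPre.phi R A p)
  | phi_mul_ideal (p : Nat.Primes) (a : A) :
      URel (UPre.phi R A p * UPre.of (Unitization.inr a)) 0

/-- The universal enveloping algebra `U(A) = A₊ ⊗_R U(0)`, where
`U(0) = R[φ_p : p prime] / (p φ_p)` with `φ_p r = r ^ p φ_p`, and the product of `U(A)` extends those of
`A₊` and `U(0)` by `(a ⊗ 1) (1 ⊗ u) = a ⊗ u` and `(1 ⊗ φ_p) (a ⊗ 1) = 0` for `a ∈ A`. It is given here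
by generators and relations. (The symbols `φ_p` and `φ_q` for distinct primes commute, because the
relations force both products to be killed by `p` and by `q`, hence to vanish.) -/
abbrev U : Type (max u v) := RingQuot (URel R A)

namespace U

/-- The quotient map from the free ring. -/
noncomputable def mk : UPre R A →+* U R A := RingQuot.mkRingHom (URel R A)

/-- The ring map `A₊ → U(A)`. -/
noncomputable def ofUnitization : Unitization R A →+* U R A :=
  RingHom.mk'
    { toFun := fun x => mk R A (UPre.of x)
      map_one' := (RingQuot.mkRingHom_rel URel.one).trans (map_one (mk R A))
      map_mul' := fun x y => (RingQuot.mkRingHom_rel (URel.mul x y)).trans (map_mul (mk R A) _ _) }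
    (fun x y => (RingQuot.mkRingHom_rel (URel.add x y)).trans (map_add (mk R A) _ _))

/-- The element `φ_n` of `U(A)`, for every `n`: `φ_1 = 1`, `φ_{p ^ e} = φ_p ^ e` for `p` prime and
`e ≥ 1`, and `φ_n = 0` if `n` is not a prime power. -/
noncomputable def phi (n : ℕ) : U R A :=
  open Classical in
  if n = 1 then 1
  else if h : IsPrimePow n then
    mk R A (UPre.phi R A ⟨n.minFac, Nat.minFac_prime h.ne_one⟩) ^ n.factorization n.minFac
  else 0

variable {R A}
variable {M : Type w} [AddCommGroup M] [Module (U R A) M]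

/-- The second component `φ_n x + ∑_{i + j = n} γ_i(a) φ_j x` (with `i, j > 0`) of the `n`-th divided
power of `(a, x)` in the DP algebra `A ⊕ M` belonging to a left `U(A)`-module `M`. -/
noncomputable def dpowSnd (γ : DPStructure R A) (n : ℕ) (a : A) (x : M) : M :=
  phi R A n • x +
    ∑ i ∈ Finset.Ioo 0 n, ofUnitization R A (γ.dpow i a : Unitization R A) • phi R A (n - i) • x

/-- `s : A → M` is a DP derivation into the left `U(A)`-module `M`: it is `R`-linear, and `a ↦ (a, s a)`
respects the products and the divided powers of `A` and of `A ⊕ M`. -/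
structure IsDPDerivation (γ : DPStructure R A) (s : A → M) : Prop where
  map_add : ∀ a b, s (a + b) = s a + s b
  map_smul : ∀ (r : R) a, s (r • a) = ofUnitization R A (Unitization.inl r) • s a
  leibniz : ∀ a b, s (a * b) =
    ofUnitization R A (a : Unitization R A) • s b + ofUnitization R A (b : Unitization R A) • s a
  map_dpow : ∀ n, 0 < n → ∀ a, s (γ.dpow n a) = dpowSnd γ n a (s a)

/-- `s : A → M` is universal among DP derivations into left `U(A)`-modules. -/
def IsUniversal (γ : DPStructure R A) (s : A → M) : Prop :=
  ∀ (N : Type t) [AddCommGroup N] [Module (U R A) N] (t : A → N), IsDPDerivation γ t →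
    ∃! f : M →ₗ[U R A] N, ∀ a, f (s a) = t a

end U

end Enveloping

section Kaehler

variable (R : Type u) [CommRing R]
  (A : Type v) [NonUnitalCommRing A] [Module R A] [IsScalarTower R A A] [SMulCommClass R A A]

/-- The ordinary Kähler differentials of the non-unital algebra `A` over `R`, an `A₊`-module:
`R`-linear derivations of `A` are the same as `R`-linear derivations of the unital `R`-algebra `A₊`. -/
abbrev OmegaCA := KaehlerDifferential R (Unitization R A)

/-- The universal (ordinary) derivation `d : A → Ω`. -/
noncomputable def dCA (a : A) : OmegaCA R A :=
  KaehlerDifferential.D R (Unitization R A) (a : Unitization R A)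

variable {R A}

/-- A left `U(A)`-module structure on an `A₊`-module that extends the `A₊`-module structure. -/
def U.Extends {M : Type w} [AddCommGroup M] [Module (Unitization R A) M] (_ : Module (U R A) M) :
    Prop :=
  ∀ (x : Unitization R A) (m : M), U.ofUnitization R A x • m = x • m

end Kaehler

end DPKaehler

universe u v w

/-! Collect the divided powers of `a` in the series `γ_t(a) = 1 + ∑ γ_n(a) t ^ n` over `A₊`. It is
multiplicative, `γ_t(a + b) = γ_t(a) γ_t(b)`, so it is invertible with inverse `γ_t(-a)`. If `d` is
to be a DP derivation, then `d γ_t(a) = γ_t(a) · ∑ φ_n(da) t ^ n`, and `φ_n(da)` has to be the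
`n`-th coefficient `ψ_n(a)` of the logarithmic derivative `γ_t(a)⁻¹ d γ_t(a)`. This gives
uniqueness, and the same recursion shows that the `A₊`-linear map induced by any DP derivation
commutes with the `φ_n`, which gives universality (`map_phi_of_isDerivation`).

For existence, `ψ_n` has to extend from the elements `da` to all of `Ω`. Logarithmic derivatives are
additive; moreover `ψ_n(r a) = r ^ n ψ_n(a)`, `ψ_n(a b) = 0` for `n > 1` (`psi_mul`), and `ψ_n(a)`
is killed by the binomial coefficients `n.choose i`, `0 < i < n` (`chooseKilled_psi`). On elements
killed in this way `r ↦ r ^ n` acts additively, so `ψ_n` is an ordinary derivation into a twisted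
module and factors through `Ω`. The composition rule `φ_m φ_n = m.uniformBell n • φ_{mn}` comes from
`psi_dpow`.

The notion in the middle is `PhiSystem`: additive operations `φ_n` on an `A₊`-module with these
properties. Such a system is the same as a DP module structure on `M`, because the group law of an
abelian object is forced by its zero section and its kernel has square zero. It is also the same as
a `U(A)`-module structure, because the middle binomial coefficients of `n` have gcd `p` if `n` is a
power of the prime `p`, and gcd `1` if `n > 1` is not a prime power.

The hard axiom for `A ⊕ M` is the one for `γ_m ∘ γ_n`. Compared coefficient by coefficient, it
becomes a congruence for uniform Bell numbers modulo `p` (`uniformBell_zmod`). -/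

namespace DPKaehler

universe t

set_option linter.unusedSectionVars false

section

/-! ### Binomial coefficients and uniform Bell numbers modulo a prime. -/

section Arithmetic

/-- `y` is killed by all the binomial coefficients `l.choose i`, `0 < i < l`. -/
def ChooseKilled {M : Type*} [AddCommMonoid M] (l : ℕ) (y : M) : Prop :=
  ∀ i, 0 < i → i < l → l.choose i • y = 0

/-- On `y` the polynomial `(1 + T) ^ l` acts as `1 + T ^ l`: in Vandermonde's sum only the terms `0`
and `l` survive. -/
theorem ChooseKilled.choose_add_nsmul {M : Type*} [AddCommMonoid M] {l : ℕ} {y : M}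
    (h : ChooseKilled l y) (hl : 0 < l) (N k : ℕ) :
    (l + N).choose k • y = (if l ≤ k then N.choose (k - l) else 0) • y + N.choose k • y := by
  rw [Nat.add_choose_eq, Finset.sum_smul, Finset.Nat.sum_antidiagonal_eq_sum_range_succ_mk,
    Finset.sum_range_succ']
  simp only [Nat.choose_zero_right, one_mul, Nat.sub_zero]
  congr 1
  have key : ∀ i, i ≠ l - 1 →
      (l.choose (i + 1) * N.choose (k - (i + 1))) • y = 0 := by
    intro i hi
    rcases lt_or_ge (i + 1) l with h1 | h1
    · rw [mul_comm, mul_smul, h _ (Nat.succ_pos _) h1, smul_zero]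
    · rw [Nat.choose_eq_zero_of_lt (by omega), zero_mul, zero_smul]
  split_ifs with hk
  · rw [Finset.sum_eq_single (l - 1) (fun i _ hi => key i hi)
      (fun hi => absurd (Finset.mem_range.2 (by omega)) hi), Nat.sub_add_cancel hl,
      Nat.choose_self, one_mul]
  · rw [zero_smul]
    refine Finset.sum_eq_zero fun i hi => key i ?_
    have := Finset.mem_range.1 hi
    omega

variable {p : ℕ} [Fact p.Prime]

theorem chooseKilled_one_zmod (e : ℕ) : ChooseKilled (p ^ e) (1 : ZMod p) := by
  intro i hi hil
  rw [nsmul_eq_mul, mul_one, ZMod.natCast_eq_zero_iff]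
  exact (Fact.out : p.Prime).dvd_choose_pow hi.ne' hil.ne

/-- Modulo `p`, `(1 + T) ^ N = (1 + T ^ (p ^ e)) (1 + T) ^ (N - p ^ e)`. -/
theorem choose_eq_zmod {e N k : ℕ} (h : p ^ e ≤ N) :
    (N.choose k : ZMod p) =
      (if p ^ e ≤ k then ((N - p ^ e).choose (k - p ^ e) : ZMod p) else 0)
        + (N - p ^ e).choose k := by
  have := (chooseKilled_one_zmod (p := p) e).choose_add_nsmul
    (pow_pos (Fact.out : p.Prime).pos e) (N - p ^ e) k
  rw [Nat.add_sub_cancel' h] at this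
  simp only [nsmul_eq_mul, mul_one] at this
  rw [this]
  push_cast
  rfl

/-- Both sides count ordered pairs of disjoint subsets of sizes `a` and `b`. -/
theorem choose_mul_choose_sub_comm (N a b : ℕ) :
    N.choose a * (N - a).choose b = N.choose b * (N - b).choose a := by
  have h1 := Nat.choose_mul (n := N) (k := a + b) (s := a) (by omega)
  have h2 := Nat.choose_mul (n := N) (k := a + b) (s := b) (by omega)
  rw [Nat.add_sub_cancel_left] at h1
  rw [Nat.add_sub_cancel] at h2
  rw [← h1, ← h2, Nat.choose_symm_add]

/-- The number of ordered partitions of a set of `m * n` elements into `m` blocks of size `n`. -/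
theorem factorial_mul_uniformBell_succ (m : ℕ) {n : ℕ} (hn : 0 < n) :
    (m + 1).factorial * (m + 1).uniformBell n =
      ((m + 1) * n).choose n * (m.factorial * m.uniformBell n) := by
  obtain ⟨n, rfl⟩ := Nat.exists_eq_succ_of_ne_zero hn.ne'
  rw [Nat.uniformBell_succ_left, Nat.factorial_succ]
  have h : (m + 1) * (m * (n + 1) + (n + 1) - 1).choose n =
      ((m + 1) * (n + 1)).choose (n + 1) := by
    have h1 := Nat.add_one_mul_choose_eq (m * (n + 1) + n) n
    have e1 : m * (n + 1) + n + 1 = (m + 1) * (n + 1) := by ring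
    rw [e1] at h1
    have e2 : m * (n + 1) + (n + 1) - 1 = m * (n + 1) + n := by omega
    rw [e2]
    apply Nat.eq_of_mul_eq_mul_right (Nat.succ_pos n)
    rw [Nat.succ_eq_add_one] at *
    linarith
  rw [Nat.succ_eq_add_one, Nat.add_sub_cancel, ← h]
  ring

/-- The left side is the coefficient of `∏ x_i ^ n` in `(x_0 + ⋯ + x_m) ^ ((m + 1) n)`. Modulo `p`
one may split off the factor `∑ x_i ^ (p ^ e)`, and each of its `m + 1` terms contributes equally.
The induction peels off one variable at a time. -/
theorem factorial_mul_uniformBell_zmod {e m n : ℕ} (hn : 0 < n) (h : p ^ e ≤ (m + 1) * n) :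
    (((m + 1).factorial * (m + 1).uniformBell n : ℕ) : ZMod p) =
      (m + 1) * (if p ^ e ≤ n then (((m + 1) * n - p ^ e).choose (n - p ^ e) : ZMod p) else 0) *
        (m.factorial * m.uniformBell n : ℕ) := by
  induction m with
  | zero =>
    simp only [zero_add, one_mul] at h ⊢
    simp [h, Nat.uniformBell_one_left, Nat.uniformBell_zero_left]
  | succ m ih =>
    rw [factorial_mul_uniformBell_succ _ hn, Nat.cast_mul, choose_eq_zmod h]
    have hexp : (m + 1 + 1) * n = (m + 1) * n + n := by ring
    rcases le_or_gt (p ^ e) ((m + 1) * n) with h1 | h1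
    · split_ifs with h2
      -- Exchanges the order in which a full block of size `n` and the shortened block of size `n -
      -- p ^ e` are chosen.
      · have hc := choose_mul_choose_sub_comm ((m + 1 + 1) * n - p ^ e) n (n - p ^ e)
        rw [show (m + 1 + 1) * n - p ^ e - n = (m + 1) * n - p ^ e by omega,
          show (m + 1 + 1) * n - p ^ e - (n - p ^ e) = (m + 1) * n by omega] at hc
        have hc' := congrArg (Nat.cast : ℕ → ZMod p) hc
        rw [Nat.cast_mul, Nat.cast_mul] at hc'
        have hM := ih h1
        rw [if_pos h2] at hM
        have hM' := congrArg (Nat.cast : ℕ → ZMod p) (factorial_mul_uniformBell_succ m hn)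
        rw [Nat.cast_mul] at hM'
        push_cast at *
        rw [add_mul, hM]
        rw [hM] at hM'
        linear_combination ((m : ZMod p) + 1) * (m.factorial * m.uniformBell n) * hc'
          - (m + 1) * ((((m + 1 + 1) * n - p ^ e).choose (n - p ^ e) : ℕ) : ZMod p) * hM'
      · have hM := ih h1
        rw [if_neg h2, mul_zero, zero_mul] at hM
        rw [hM]; ring
    · have h2 : ¬ p ^ e ≤ n := by
        have := Nat.le_mul_of_pos_left n m.succ_pos
        rw [Nat.succ_eq_add_one] at this
        omega
      rw [if_neg h2, Nat.choose_eq_zero_of_lt (by omega)]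
      simp

theorem choose_pow_mul_zmod (e a b : ℕ) :
    ((p ^ e * a).choose (p ^ e * b) : ZMod p) = a.choose b :=
  (ZMod.natCast_eq_natCast_iff _ _ _).2 Choose.choose_pow_mul_pow_mul_modEq_choose_nat

/-- Lucas: the last `e` digits of both numbers in base `p` are all `p - 1`, and what precedes them
is `a` and `b`. -/
theorem choose_pow_mul_sub_one_zmod (e a b : ℕ) :
    ((p ^ e * (a + 1) - 1).choose (p ^ e * (b + 1) - 1) : ZMod p) = a.choose b := by
  have hp := (Fact.out : p.Prime).pos
  induction e generalizing a b with
  | zero => simp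
  | succ e ih =>
    have h : ∀ c, p ^ (e + 1) * (c + 1) - 1 = p ^ e * ((p * c + (p - 1)) + 1) - 1 := by
      intro c
      congr 1
      rw [pow_succ, mul_assoc, add_assoc, Nat.sub_add_cancel hp]
      ring
    rw [h, h, ih]
    refine ((ZMod.natCast_eq_natCast_iff _ _ _).2
      Choose.choose_modEq_choose_mod_mul_choose_div_nat).trans ?_
    have h1 : ∀ c, (p * c + (p - 1)) % p = p - 1 := fun c => by
      rw [Nat.mul_add_mod, Nat.mod_eq_of_lt (by omega)]
    have h2 : ∀ c, (p * c + (p - 1)) / p = c := fun c => by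
      rw [Nat.mul_add_div hp, Nat.div_eq_of_lt (by omega), add_zero]
    rw [h1, h1, h2, h2, Nat.choose_self, one_mul]

/-- A uniform Bell number is a product of binomials; here each factor is congruent to some `j.choose
0`. -/
theorem uniformBell_pow_zmod (m k : ℕ) : (m.uniformBell (p ^ k) : ZMod p) = 1 := by
  induction m with
  | zero => simp [Nat.uniformBell_zero_left]
  | succ m ih =>
    have := choose_pow_mul_sub_one_zmod (p := p) k m 0
    rw [Nat.choose_zero_right, Nat.cast_one, zero_add, mul_one] at this
    rw [Nat.uniformBell_succ_left, Nat.cast_mul, ih, mul_one, ← this, mul_add, mul_one, mul_comm m]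

/-- Legendre: `(p - 1) v_p(n!)` is `n` minus the digit sum of `n` in base `p`, and the digit sum is
at least `2` unless `n` is a power of `p`. The induction strips the last digit. -/
theorem sub_one_mul_padicValNat_factorial_add_two_le {n : ℕ} (hn : 0 < n)
    (h : ∀ k, n ≠ p ^ k) : (p - 1) * padicValNat p n.factorial + 2 ≤ n := by
  have hp := (Fact.out : p.Prime).two_le
  induction n using Nat.strong_induction_on with
  | _ n ih =>
    have hv : padicValNat p n.factorial = padicValNat p (n / p).factorial + n / p := by
      conv_lhs => rw [← Nat.div_add_mod n p]
      rw [padicValNat_factorial_mul_add _ (Nat.mod_lt _ (by omega)), padicValNat_factorial_mul]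
    have hdm := Nat.div_add_mod n p
    obtain ⟨q, hq⟩ : ∃ q, q = n / p := ⟨_, rfl⟩
    obtain ⟨r, hr⟩ : ∃ r, r = n % p := ⟨_, rfl⟩
    rw [← hq, ← hr] at hdm
    rw [hv, ← hq, mul_add]
    have hpq : (p - 1) * q + q = p * q := by
      rw [← Nat.succ_mul, Nat.succ_eq_add_one, Nat.sub_add_cancel (by omega)]
    rcases Nat.eq_zero_or_pos q with h0 | h0
    · have := h 0
      simp [h0]
      rw [pow_zero] at this
      omega
    · rcases Nat.eq_zero_or_pos r with h1 | h1
      · have hqn : q < n := by nlinarith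
        have := ih q hqn h0 (fun k hk => h (k + 1) (by rw [← hdm, h1, hk, pow_succ]; ring))
        omega
      · have := sub_one_mul_padicValNat_factorial_lt_of_ne_zero p h0.ne'
        omega

/-- `p.uniformBell n` divides every later one, and its `p`-adic valuation is `n - 1 - (p - 1)
v_p(n!)`, which is positive by Legendre's formula. -/
theorem uniformBell_zmod_eq_zero_of_ne_pow {m n : ℕ} (hm : p ≤ m) (hn : 0 < n)
    (h : ∀ k, n ≠ p ^ k) : (m.uniformBell n : ZMod p) = 0 := by
  induction m, hm using Nat.le_induction with
  | succ m _ ih => rw [Nat.uniformBell_succ_left, Nat.cast_mul, ih, mul_zero]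
  | base =>
    have hp := (Fact.out : p.Prime).two_le
    rw [ZMod.natCast_eq_zero_iff]
    have hB := Nat.uniformBell_mul_eq p hn.ne'
    have hB0 : p.uniformBell n ≠ 0 := by
      intro h0
      rw [h0] at hB
      simp only [zero_mul] at hB
      exact (Nat.factorial_ne_zero _) hB.symm
    have hv := congrArg (padicValNat p) hB
    have hf := Nat.factorial_ne_zero n
    have hvp : padicValNat p p.factorial = 1 := by
      have := padicValNat_factorial_mul (p := p) 1
      simpa using this
    rw [padicValNat.mul (mul_ne_zero hB0 (pow_ne_zero _ hf)) (Nat.factorial_ne_zero _),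
      padicValNat.mul hB0 (pow_ne_zero _ hf), padicValNat.pow, padicValNat_factorial_mul,
      hvp] at hv
    have h2 := sub_one_mul_padicValNat_factorial_add_two_le hn h
    have h3 : (p - 1) * padicValNat p n.factorial + padicValNat p n.factorial =
        p * padicValNat p n.factorial := by
      rw [← Nat.succ_mul, Nat.succ_eq_add_one, Nat.sub_add_cancel (by omega)]
    exact dvd_of_one_le_padicValNat (by omega)

/-- Counting the partitions of a set of `m * n` elements into `m` blocks of size `n`, modulo `p`,
by means of a cyclic permutation of `p ^ e` of the elements. -/
theorem uniformBell_zmod {e m n : ℕ} (hm : 0 < m) (hn : 0 < n) (h : p ^ e ≤ m * n) :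
    (m.uniformBell n : ZMod p) =
      (if p ^ e ≤ n then
        ((m - 1).uniformBell n * (m * n - p ^ e).choose (n - p ^ e) : ZMod p) else 0) +
      (if n ∣ p ^ e ∧ n < p ^ e then
        ((p ^ e / n).uniformBell n * (m - p ^ e / n).uniformBell n : ZMod p) else 0) := by
  have hpp := (Fact.out : p.Prime)
  obtain ⟨m, rfl⟩ := Nat.exists_eq_succ_of_ne_zero hm.ne'
  rw [Nat.succ_eq_add_one, Nat.add_sub_cancel] at *
  by_cases hpow : ∃ k, n = p ^ k
  · obtain ⟨k, rfl⟩ := hpow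
    rw [uniformBell_pow_zmod, uniformBell_pow_zmod, uniformBell_pow_zmod, uniformBell_pow_zmod]
    rcases le_or_gt e k with hek | hek
    · have hle := Nat.pow_le_pow_right hpp.pos hek
      rw [if_pos hle, if_neg (by omega), add_zero, one_mul]
      obtain ⟨d, rfl⟩ := Nat.exists_eq_add_of_le hek
      have hd : 0 < p ^ d := pow_pos hpp.pos d
      have e1 : (m + 1) * p ^ (e + d) - p ^ e = p ^ e * (p ^ d * (m + 1) - 1) := by
        rw [Nat.mul_sub, pow_add]; ring_nf
      have e2 : p ^ (e + d) - p ^ e = p ^ e * (p ^ d * (0 + 1) - 1) := by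
        rw [Nat.mul_sub, pow_add]; ring_nf
      rw [e1, e2, choose_pow_mul_zmod, choose_pow_mul_sub_one_zmod, Nat.choose_zero_right,
        Nat.cast_one]
    · have hlt := Nat.pow_lt_pow_right hpp.one_lt hek
      rw [if_neg (by omega), if_pos ⟨pow_dvd_pow p hek.le, hlt⟩]
      ring
  -- If `n` is not a power of `p`, it does not divide `p ^ e` and the second term is absent.
  · push Not at hpow
    have hnd : ¬ n ∣ p ^ e := fun hd => by
      obtain ⟨k, _, hk⟩ := (Nat.dvd_prime_pow hpp).1 hd
      exact hpow k hk
    rw [if_neg (c := n ∣ p ^ e ∧ _) (fun h => hnd h.1), add_zero]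
    -- For `m + 1 < p` the factorial `(m + 1)!` is invertible modulo `p` and can be cancelled. For
    -- `m + 1 > p` both Bell numbers vanish. For `m + 1 = p` only the left one is known to vanish,
    -- and the product on the right needs an argument.
    rcases lt_trichotomy (m + 1) p with hmp | hmp | hmp
    · have key := factorial_mul_uniformBell_zmod hn h
      have hf : (((m + 1).factorial : ℕ) : ZMod p) ≠ 0 := by
        rw [Ne, ZMod.natCast_eq_zero_iff, hpp.dvd_factorial]
        omega
      apply mul_left_cancel₀ hf
      rw [← Nat.cast_mul, key, Nat.factorial_succ]
      split_ifs <;> push_cast <;> ring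
    · rw [hmp, uniformBell_zmod_eq_zero_of_ne_pow le_rfl hn hpow]
      split_ifs with hle
      swap
      · rfl
      -- With `n = p ^ e (b + 1)` and `c + 1 = p (b + 1)`, the binomial on the right is congruent to
      -- `c.choose b`. So is the factor that leads from `m.uniformBell n` to `p.uniformBell n`,
      -- which is zero modulo `p`.
      by_cases hd : p ^ e ∣ n
      · obtain ⟨b, rfl⟩ := hd
        obtain ⟨b, rfl⟩ := Nat.exists_eq_succ_of_ne_zero
          (fun hb : b = 0 => by simp [hb] at hn)
        have h0 := uniformBell_zmod_eq_zero_of_ne_pow (p := p) hmp.ge hn hpow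
        rw [Nat.uniformBell_succ_left, Nat.cast_mul] at h0
        have hpb : 0 < p * (b + 1) := Nat.mul_pos hpp.pos b.succ_pos
        have e0 : m * (p ^ e * b.succ) + p ^ e * b.succ = p ^ e * (p * (b + 1)) := by
          rw [← Nat.succ_mul, Nat.succ_eq_add_one m, hmp, Nat.succ_eq_add_one]; ring
        rw [e0] at h0
        obtain ⟨c, hc⟩ := Nat.exists_eq_succ_of_ne_zero hpb.ne'
        have e1 : p * (p ^ e * b.succ) - p ^ e = p ^ e * c := by
          rw [show p * (p ^ e * b.succ) = p ^ e * (p * (b + 1)) by rw [Nat.succ_eq_add_one]; ring,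
            hc, Nat.mul_succ, Nat.add_sub_cancel]
        have e2 : p ^ e * b.succ - p ^ e = p ^ e * b := by rw [Nat.mul_succ, Nat.add_sub_cancel]
        rw [hc, Nat.succ_eq_add_one, Nat.succ_eq_add_one, choose_pow_mul_sub_one_zmod] at h0
        rw [e1, e2, choose_pow_mul_zmod, mul_comm, Nat.succ_eq_add_one, h0]
      -- After dividing by the exact power `p ^ k` of `p` in `n`, the top of the binomial is
      -- divisible by `p` and the bottom is not, so it vanishes by Lucas.
      · obtain ⟨k, n', hn', rfl⟩ := Nat.exists_eq_pow_mul_and_not_dvd hn.ne' p hpp.ne_one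
        have hke : k < e := by
          by_contra hke
          exact hd ((pow_dvd_pow p (not_lt.1 hke)).trans (dvd_mul_right _ _))
        obtain ⟨d, rfl⟩ := Nat.exists_eq_add_of_lt hke
        have e1 : p * (p ^ k * n') - p ^ (k + d + 1) = p ^ k * (p * (n' - p ^ d)) := by
          rw [Nat.mul_sub, Nat.mul_sub]
          ring_nf
        have e2 : p ^ k * n' - p ^ (k + d + 1) = p ^ k * (n' - p * p ^ d) := by
          rw [Nat.mul_sub]
          ring_nf
        have hle' : p * p ^ d ≤ n' := by
          refine le_of_mul_le_mul_left (a := p ^ k) ?_ (pow_pos hpp.pos k)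
          calc p ^ k * (p * p ^ d) = p ^ (k + d + 1) := by ring
            _ ≤ _ := hle
        have hz : ((p * (n' - p ^ d)).choose (n' - p * p ^ d) : ZMod p) = 0 := by
          refine ((ZMod.natCast_eq_natCast_iff _ _ _).2
            Choose.choose_modEq_choose_mod_mul_choose_div_nat).trans ?_
          rw [Nat.mul_mod_right, Nat.choose_eq_zero_of_lt, zero_mul, Nat.cast_zero]
          refine Nat.pos_of_ne_zero fun h0 => hn' ?_
          have := (Nat.dvd_of_mod_eq_zero h0).add (dvd_mul_right p (p ^ d))
          rwa [Nat.sub_add_cancel hle'] at this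
        rw [e1, e2, choose_pow_mul_zmod, hz, mul_zero]
    · rw [uniformBell_zmod_eq_zero_of_ne_pow (by omega) hn hpow,
        uniformBell_zmod_eq_zero_of_ne_pow (by omega) hn hpow]
      simp

end Arithmetic

end

section

/-! ### Elements killed by the middle binomial coefficients. -/

section ChooseKilled

variable {M : Type*} [AddCommGroup M] {l : ℕ} {y : M}

/-- For `l > 1` the gcd is `p` if `l` is a power of the prime `p`, and `1` otherwise. So
`ChooseKilled l y` reduces to `p • y = 0` or to `y = 0`. -/
theorem ChooseKilled.addOrderOf_dvd_gcd (h : ChooseKilled l y) :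
    addOrderOf y ∣ (Finset.Icc 1 (l - 1)).gcd l.choose := by
  refine Finset.dvd_gcd fun i hi => addOrderOf_dvd_iff_nsmul_eq_zero.2 ?_
  rw [Finset.mem_Icc] at hi
  exact h i (by omega) (by omega)

theorem ChooseKilled.eq_zero (h : ChooseKilled l y) (hl : 1 < l) (hl' : ¬ IsPrimePow l) :
    y = 0 := by
  have := h.addOrderOf_dvd_gcd
  rw [Choose.gcd_choose_eq_one_of_not_isPrimePow hl hl', Nat.dvd_one] at this
  exact AddMonoid.addOrderOf_eq_one_iff.1 this

theorem ChooseKilled.prime_nsmul {p e : ℕ} (hp : p.Prime) (he : e ≠ 0)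
    (h : ChooseKilled (p ^ e) y) : p • y = 0 := by
  have := h.addOrderOf_dvd_gcd
  rw [Choose.gcd_choose_eq_minFac_of_isPrimePow (hp.isPrimePow.pow he), hp.pow_minFac he] at this
  exact addOrderOf_dvd_iff_nsmul_eq_zero.1 this

theorem nsmul_eq_nsmul_of_zmod {p a b : ℕ} (h : p • y = 0) (hab : (a : ZMod p) = b) :
    a • y = b • y :=
  nsmul_eq_nsmul_iff_modEq.2
    (((ZMod.natCast_eq_natCast_iff _ _ _).1 hab).of_dvd (addOrderOf_dvd_of_nsmul_eq_zero h))

theorem ChooseKilled.uniformBell_nsmul (h : ChooseKilled l y) (hl : 0 < l) {m n : ℕ}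
    (hm : 0 < m) (hn : 0 < n) (hlmn : l ≤ m * n) :
    m.uniformBell n • y =
      (if l ≤ n then (m - 1).uniformBell n * (m * n - l).choose (n - l) else 0) • y +
      (if n ∣ l ∧ n < l then (l / n).uniformBell n * (m - l / n).uniformBell n else 0) • y := by
  -- For `l = 1` nothing is assumed of `y`, and the identity is the exact recursion of the uniform
  -- Bell numbers.
  rcases Nat.eq_or_lt_of_le hl with rfl | hl1
  · obtain ⟨m, rfl⟩ := Nat.exists_eq_succ_of_ne_zero hm.ne'
    rw [if_pos (by omega), if_neg (by omega), Nat.uniformBell_succ_left, zero_smul, add_zero,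
      Nat.succ_mul, Nat.succ_sub_one, mul_comm]
  · by_cases hpl : IsPrimePow l
    · obtain ⟨p, e, hp, he, rfl⟩ := (isPrimePow_nat_iff l).1 hpl
      have : Fact p.Prime := ⟨hp⟩
      rw [← add_smul]
      refine nsmul_eq_nsmul_of_zmod (h.prime_nsmul hp he.ne') ?_
      rw [uniformBell_zmod hm hn hlmn]
      push_cast
      rfl
    · rw [h.eq_zero hl1 hpl]
      simp

end ChooseKilled

/-! ### Power series with scalar coefficients acting on series with vector coefficients. -/

section Convolution

variable {S M : Type*} [CommRing S] [AddCommGroup M] [Module S M]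

/-- The convolution of a sequence of scalars with a sequence of vectors. -/
def conv (f : ℕ → S) (y : ℕ → M) (n : ℕ) : M :=
  ∑ x ∈ Finset.HasAntidiagonal.antidiagonal n, f x.1 • y x.2

theorem conv_eq_sum_range (f : ℕ → S) (y : ℕ → M) (n : ℕ) :
    conv f y n = ∑ l ∈ Finset.range (n + 1), f (n - l) • y l := by
  rw [conv, ← Finset.Nat.sum_antidiagonal_swap, Finset.Nat.sum_antidiagonal_eq_sum_range_succ_mk]
  rfl

theorem conv_eq_sum_ite (f : ℕ → S) (y : ℕ → M) {n N : ℕ} (h : n ≤ N) :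
    conv f y n = ∑ l ∈ Finset.range (N + 1), if l ≤ n then f (n - l) • y l else 0 := by
  rw [conv_eq_sum_range, ← Finset.sum_filter]
  refine Finset.sum_congr ?_ fun _ _ => rfl
  ext l
  simp only [Finset.mem_range, Finset.mem_filter]
  omega

theorem conv_conv (f g : ℕ → S) (y : ℕ → M) : conv f (conv g y) = conv (conv f g) y := by
  ext n
  simp only [conv, Finset.smul_sum, Finset.sum_smul, Finset.sum_sigma', smul_smul, smul_eq_mul]
  refine (Finset.sum_nbij' (fun ⟨⟨_i, j⟩, ⟨k, l⟩⟩ ↦ ⟨(k, l + j), (l, j)⟩)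
    (fun ⟨⟨i, _j⟩, ⟨k, l⟩⟩ ↦ ⟨(i + k, l), (i, k)⟩) ?_ ?_ ?_ ?_ ?_).symm
  all_goals
    rintro ⟨⟨i, j⟩, ⟨k, l⟩⟩ h
    obtain ⟨h1, h2⟩ := Finset.mem_sigma.1 h
    replace h1 := Finset.HasAntidiagonal.mem_antidiagonal.1 h1
    replace h2 := Finset.HasAntidiagonal.mem_antidiagonal.1 h2
    dsimp only at h1 h2
  · simp only [Finset.mem_sigma, Finset.HasAntidiagonal.mem_antidiagonal, and_true]
    omega
  · simp only [Finset.mem_sigma, Finset.HasAntidiagonal.mem_antidiagonal, and_true]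
    omega
  · subst h2; rfl
  · subst h2; rfl
  · rfl

theorem conv_comm (f g : ℕ → S) : conv f g = conv g f := by
  ext n
  rw [conv, conv, ← Finset.Nat.sum_antidiagonal_swap]
  simp [mul_comm]

theorem conv_add (f : ℕ → S) (y z : ℕ → M) : conv f (y + z) = conv f y + conv f z := by
  ext n
  simp [conv, Finset.sum_add_distrib]

theorem conv_zero_apply (f : ℕ → S) (y : ℕ → M) : conv f y 0 = f 0 • y 0 := by
  simp [conv]

theorem single_conv (y : ℕ → M) : conv (Pi.single 0 1 : ℕ → S) y = y := by
  ext n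
  rw [conv_eq_sum_range, Finset.sum_range_succ, Nat.sub_self, Pi.single_eq_same, one_smul,
    Finset.sum_eq_zero, zero_add]
  intro l hl
  have := Finset.mem_range.1 hl
  rw [Pi.single_eq_of_ne (by omega), zero_smul]

theorem sum_antidiagonal_eq_Ioo {N : Type*} [AddCommMonoid N] {n : ℕ} (hn : 0 < n)
    (f : ℕ → ℕ → N) :
    ∑ x ∈ Finset.HasAntidiagonal.antidiagonal n, f x.1 x.2 =
      f 0 n + ∑ i ∈ Finset.Ioo 0 n, f i (n - i) + f n 0 := by
  rw [Finset.Nat.sum_antidiagonal_eq_sum_range_succ_mk, Finset.sum_range_succ, Nat.sub_self,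
    Finset.range_eq_Ico, ← Finset.sum_Ioo_add_eq_sum_Ico hn, Nat.sub_zero, add_comm (f 0 n)]

end Convolution

/-! ### The divided power series of an element and the coefficient identities behind the DP axioms.
-/

section DivPow

variable {R : Type u} [CommRing R]
  {A : Type v} [NonUnitalCommRing A] [Module R A] [IsScalarTower R A A] [SMulCommClass R A A]

namespace DPStructure

/-- The divided powers of an element of `A`, as elements of `A₊`, with `0`-th divided power `1`. -/
def divPow (γ : DPStructure R A) (a : A) (n : ℕ) : Unitization R A :=
  if n = 0 then 1 else (γ.dpow n a : Unitization R A)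

variable (γ : DPStructure R A)

@[simp] theorem divPow_zero (a : A) : γ.divPow a 0 = 1 := rfl

theorem divPow_of_pos {n : ℕ} (hn : 0 < n) (a : A) : γ.divPow a n = (γ.dpow n a : Unitization R A) :=
  if_neg hn.ne'

theorem divPow_one (a : A) : γ.divPow a 1 = (a : Unitization R A) := by
  rw [γ.divPow_of_pos one_pos, γ.dpow_one]

theorem dpow_zero_right (n : ℕ) : γ.dpow n 0 = 0 := by
  rcases Nat.eq_zero_or_pos n with rfl | hn
  · exact γ.dpow_index_zero 0
  · have := γ.dpow_smul n hn 0 0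
    rwa [zero_smul, zero_pow hn.ne', zero_smul] at this

theorem divPow_zero_right : γ.divPow 0 = Pi.single 0 1 := by
  ext1 n
  rcases Nat.eq_zero_or_pos n with rfl | hn
  · simp
  · rw [γ.divPow_of_pos hn, γ.dpow_zero_right, Unitization.inr_zero, Pi.single_eq_of_ne hn.ne']

theorem divPow_add (a b : A) : γ.divPow (a + b) = conv (γ.divPow a) (γ.divPow b) := by
  ext1 n
  rcases Nat.eq_zero_or_pos n with rfl | hn
  · simp [conv]
  · rw [conv, sum_antidiagonal_eq_Ioo hn (fun i j => γ.divPow a i • γ.divPow b j),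
      γ.divPow_of_pos hn, γ.dpow_add n hn, divPow_zero, divPow_zero, γ.divPow_of_pos hn,
      γ.divPow_of_pos hn, one_smul, smul_eq_mul, mul_one, Unitization.inr_add, Unitization.inr_add,
      ← Unitization.inrHom_apply R R A, ← Unitization.inrHom_apply R R A, map_sum]
    have : ∑ i ∈ Finset.Ioo 0 n, Unitization.inrHom R R A (γ.dpow i a * γ.dpow (n - i) b) =
        ∑ i ∈ Finset.Ioo 0 n, γ.divPow a i • γ.divPow b (n - i) := by
      refine Finset.sum_congr rfl fun i hi => ?_
      rw [Finset.mem_Ioo] at hi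
      rw [γ.divPow_of_pos hi.1, γ.divPow_of_pos (by omega), smul_eq_mul, ← Unitization.inr_mul]
      rfl
    rw [this]
    simp only [Unitization.inrHom_apply]
    abel

/-- The divided power series is invertible; this is what makes logarithmic derivatives available. -/
theorem divPow_neg_conv (a : A) : conv (γ.divPow (-a)) (γ.divPow a) = Pi.single 0 1 := by
  rw [← divPow_add, neg_add_cancel, divPow_zero_right]

theorem divPow_smul (r : R) (a : A) (n : ℕ) :
    γ.divPow (r • a) n = Unitization.inl (r ^ n) * γ.divPow a n := by
  rcases Nat.eq_zero_or_pos n with rfl | hn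
  · simp
  · rw [γ.divPow_of_pos hn, γ.divPow_of_pos hn, γ.dpow_smul n hn, Unitization.inl_mul_inr]

theorem inr_iterate_mul (a b : A) (n : ℕ) :
    (((fun x => a * x)^[n] b : A) : Unitization R A) =
      (a : Unitization R A) ^ n * (b : Unitization R A) := by
  induction n with
  | zero => simp
  | succ n ih => rw [Function.iterate_succ_apply', Unitization.inr_mul, ih, pow_succ']; ring

theorem divPow_mul_left (a b : A) (n : ℕ) :
    γ.divPow (a * b) n = (a : Unitization R A) ^ n * γ.divPow b n := by
  rcases Nat.eq_zero_or_pos n with rfl | hn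
  · simp
  · rw [γ.divPow_of_pos hn, γ.divPow_of_pos hn, γ.dpow_mul n hn, inr_iterate_mul]

theorem divPow_mul_divPow (a : A) (m n : ℕ) :
    γ.divPow a m * γ.divPow a n = (m + n).choose m • γ.divPow a (m + n) := by
  rcases Nat.eq_zero_or_pos m with rfl | hm
  · simp
  rcases Nat.eq_zero_or_pos n with rfl | hn
  · simp
  rw [γ.divPow_of_pos hm, γ.divPow_of_pos hn, γ.divPow_of_pos (by omega), ← Unitization.inr_mul,
    γ.mul_dpow m n hm hn, ← Nat.add_choose, Nat.choose_symm_add, Unitization.inr_smul]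

theorem divPow_dpow (a : A) (m : ℕ) {n : ℕ} (hn : 0 < n) :
    γ.divPow (γ.dpow n a) m = m.uniformBell n • γ.divPow a (m * n) := by
  rcases Nat.eq_zero_or_pos m with rfl | hm
  · simp [Nat.uniformBell_zero_left]
  rw [γ.divPow_of_pos hm, γ.divPow_of_pos (Nat.mul_pos hm hn), γ.dpow_comp m n hm hn,
    Nat.uniformBell_eq_div m hn.ne', mul_comm (n.factorial ^ m), Unitization.inr_smul]

theorem succ_nsmul_divPow (a : A) (n : ℕ) :
    (n + 1) • γ.divPow a (n + 1) = (a : Unitization R A) * γ.divPow a n := by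
  rw [← divPow_one γ a, divPow_mul_divPow, add_comm 1 n, Nat.choose_one_right]

theorem inr_pow (a : A) (n : ℕ) : (a : Unitization R A) ^ n = n.factorial • γ.divPow a n := by
  induction n with
  | zero => simp
  | succ n ih =>
    rw [pow_succ', ih, mul_smul_comm, ← succ_nsmul_divPow, smul_smul, Nat.factorial_succ, mul_comm]

variable {M : Type w} [AddCommGroup M] [Module (Unitization R A) M]

/-- `a ^ j = j! γ_j(a)`, and `j = j.choose 1` kills `y` because `j > 1`. -/
theorem inr_pow_smul_of_chooseKilled (γ : DPStructure R A) (a : A) {j n : ℕ} (hj : 1 < j) (hn : j ≤ n) {y : M}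
    (hy : ChooseKilled j y) : (a : Unitization R A) ^ n • y = 0 := by
  have h := hy 1 one_pos hj
  rw [Nat.choose_one_right] at h
  have hf : (a : Unitization R A) ^ j • y = 0 := by
    rw [γ.inr_pow, smul_assoc, smul_comm, ← Nat.mul_factorial_pred (by omega), mul_comm, mul_smul,
      h, smul_zero, smul_zero]
  obtain ⟨k, rfl⟩ := Nat.exists_eq_add_of_le hn
  rw [add_comm, pow_add, mul_smul, hf, smul_zero]

/-- The rule for `γ_m γ_n` in the second component of `A ⊕ M`. On `y l` the coefficient `(m +
n).choose m` splits into the two binomials produced by `γ_m γ_{n-l}` and `γ_n γ_{m-l}`. -/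
theorem choose_nsmul_conv_divPow (a : A) {y : ℕ → M} (h0 : y 0 = 0)
    (hy : ∀ l, ChooseKilled l (y l)) (m n : ℕ) :
    (m + n).choose m • conv (γ.divPow a) y (m + n) =
      γ.divPow a m • conv (γ.divPow a) y n + γ.divPow a n • conv (γ.divPow a) y m := by
  rw [conv_eq_sum_range, conv_eq_sum_ite _ _ (Nat.le_add_left n m),
    conv_eq_sum_ite _ _ (Nat.le_add_right m n), Finset.smul_sum, Finset.smul_sum, Finset.smul_sum,
    ← Finset.sum_add_distrib]
  refine Finset.sum_congr rfl fun l hl => ?_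
  have hl := Finset.mem_range.1 hl
  rcases Nat.eq_zero_or_pos l with rfl | hl0
  · simp [h0]
  have key := (hy l).choose_add_nsmul hl0 (m + n - l) m
  rw [show l + (m + n - l) = m + n by omega] at key
  rw [smul_comm, key, smul_add, add_comm]
  congr 1
  · split_ifs with h
    · rw [smul_smul, divPow_mul_divPow, smul_assoc, smul_comm,
        show m + (n - l) = m + n - l by omega]
    · rw [Nat.choose_eq_zero_of_lt (by omega)]
      simp
  · split_ifs with h
    · rw [smul_smul, divPow_mul_divPow, smul_assoc, smul_comm,
        show n + (m - l) = m + n - l by omega, ← Nat.choose_symm (by omega),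
        show m + n - l - (m - l) = n by omega]
    · simp

/-- The rule for `γ_m ∘ γ_n` in the second component. On the right, `y l` occurs in the term `z 1`,
and again in `z j` if `l = j * n` with `j ≥ 2`. These are the two terms of
`ChooseKilled.uniformBell_nsmul`. The sequence `z` is kept abstract so that the identity applies
both to a `PhiSystem` and to logarithmic derivatives. -/
theorem uniformBell_nsmul_conv_divPow (a : A) {y z : ℕ → M} (h0 : y 0 = 0)
    (hy : ∀ l, ChooseKilled l (y l)) {m n : ℕ} (hm : 0 < m) (hn : 0 < n)
    (hz0 : z 0 = 0) (hz1 : z 1 = conv (γ.divPow a) y n)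
    (hz : ∀ j, 2 ≤ j → j ≤ m → z j = j.uniformBell n • y (j * n)) :
    m.uniformBell n • conv (γ.divPow a) y (m * n) = conv (γ.divPow (γ.dpow n a)) z m := by
  have hright : conv (γ.divPow (γ.dpow n a)) z m =
      γ.divPow (γ.dpow n a) (m - 1) • conv (γ.divPow a) y n +
      ∑ j ∈ Finset.range (m + 1), if 2 ≤ j then
        γ.divPow (γ.dpow n a) (m - j) • j.uniformBell n • y (j * n) else 0 := by
    obtain ⟨m, rfl⟩ := Nat.exists_eq_succ_of_ne_zero hm.ne'
    rw [conv_eq_sum_range, Finset.sum_range_succ', Finset.sum_range_succ', hz0, smul_zero, add_zero,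
      Finset.sum_range_succ' (n := m.succ), Finset.sum_range_succ' (n := m), add_comm, zero_add, hz1]
    rw [if_neg (by omega), if_neg (by omega), add_zero, add_zero]
    congr 1
    refine Finset.sum_congr rfl fun j hj => ?_
    have := Finset.mem_range.1 hj
    rw [if_pos (by omega), hz _ (by omega) (by omega)]
  -- Reindexing by `l = j * n`, so that both sides become sums over `l`.
  have hsum : (∑ j ∈ Finset.range (m + 1), if 2 ≤ j then
        γ.divPow (γ.dpow n a) (m - j) • j.uniformBell n • y (j * n) else 0) =
      ∑ l ∈ Finset.range (m * n + 1), if n ∣ l ∧ n < l then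
        γ.divPow (γ.dpow n a) (m - l / n) • (l / n).uniformBell n • y l else 0 := by
    rw [← Finset.sum_filter, ← Finset.sum_filter]
    refine Finset.sum_nbij' (fun j => j * n) (fun l => l / n) ?_ ?_ ?_ ?_ ?_
    · intro j hj
      simp only [Finset.mem_filter, Finset.mem_range] at hj ⊢
      refine ⟨Nat.lt_succ_of_le (Nat.mul_le_mul_right n (by omega)), dvd_mul_left _ _, ?_⟩
      nlinarith
    · rintro l hl
      simp only [Finset.mem_filter, Finset.mem_range] at hl ⊢
      obtain ⟨hl, ⟨j, rfl⟩, h2⟩ := hl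
      rw [Nat.mul_div_cancel_left _ hn]
      constructor
      · by_contra hj
        have : n * (m + 1) ≤ n * j := Nat.mul_le_mul_left n (by omega)
        nlinarith
      · by_contra hj
        have : n * j ≤ n * 1 := Nat.mul_le_mul_left n (by omega)
        omega
    · intro j _
      exact Nat.mul_div_cancel _ hn
    · intro l hl
      simp only [Finset.mem_filter] at hl
      exact Nat.div_mul_cancel hl.2.1
    · intro j _
      rw [Nat.mul_div_cancel _ hn]
  rw [hright, hsum, conv_eq_sum_range, conv_eq_sum_ite _ _ (Nat.le_mul_of_pos_left n hm),
    Finset.smul_sum, Finset.smul_sum, ← Finset.sum_add_distrib]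
  refine Finset.sum_congr rfl fun l hl => ?_
  have hl := Finset.mem_range.1 hl
  rcases Nat.eq_zero_or_pos l with rfl | hl0
  · simp [h0]
  rw [smul_comm, (hy l).uniformBell_nsmul hl0 hm hn (by omega), smul_add]
  congr 1
  · split_ifs with h
    · have hmn : (m - 1) * n + n = m * n := by
        rw [← Nat.succ_mul, Nat.succ_eq_add_one, Nat.sub_add_cancel hm]
      rw [divPow_dpow γ a _ hn, smul_smul, smul_mul_assoc, divPow_mul_divPow,
        show (m - 1) * n + (n - l) = m * n - l by omega, mul_smul, smul_assoc, smul_assoc,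
        smul_comm (γ.divPow a (m * n - l)) ((m - 1).uniformBell n),
        smul_comm (γ.divPow a (m * n - l)) (Nat.choose _ _), ← Nat.choose_symm (by omega),
        show m * n - l - (n - l) = (m - 1) * n by omega]
    · simp
  · split_ifs with h
    · obtain ⟨⟨j, rfl⟩, h2⟩ := h
      rw [Nat.mul_div_cancel_left _ hn, divPow_dpow γ a _ hn, Nat.sub_mul, mul_comm j n,
        mul_comm (j.uniformBell n), mul_smul, smul_assoc,
        smul_comm (γ.divPow a (m * n - n * j)) ((m - j).uniformBell n)]
    · simp

end DPStructure

end DivPow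

end

section

variable {R : Type u} [CommRing R]
  {A : Type v} [NonUnitalCommRing A] [Module R A] [IsScalarTower R A A] [SMulCommClass R A A]
  {M : Type w} [AddCommGroup M] [Module (Unitization R A) M]

/-! ### From operations `φ n` on `M` to a DP module structure on `M`. -/

section PhiSystem

variable (R A M) in
/-- The operations `φ n` on `M` that make `A ⊕ M` a DP algebra: those of a left `U(A)`-module. -/
structure PhiSystem where
  /-- the operations -/
  phi : ℕ → M →+ M
  phi_zero : ∀ x, phi 0 x = 0
  phi_one : ∀ x, phi 1 x = x
  phi_inl_smul : ∀ n (r : R) x,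
    phi n ((Unitization.inl r : Unitization R A) • x) =
      (Unitization.inl (r ^ n) : Unitization R A) • phi n x
  phi_inr_smul : ∀ n, 1 < n → ∀ (a : A) x, phi n ((a : Unitization R A) • x) = 0
  chooseKilled : ∀ n x, ChooseKilled n (phi n x)
  phi_phi : ∀ m n, 0 < m → 0 < n → ∀ x, phi m (phi n x) = m.uniformBell n • phi (m * n) x

theorem conv_succ_of_single (f : ℕ → Unitization R A) {y : ℕ → M} {n : ℕ}
    (hy : ∀ j, j ≠ 1 → j ≤ n + 1 → f (n + 1 - j) • y j = 0) : conv f y (n + 1) = f n • y 1 := by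
  rw [conv_eq_sum_range, Finset.sum_eq_single 1 (fun j hl hj => hy j hj
    (Nat.lt_succ_iff.1 (Finset.mem_range.1 hl))) (fun h => ?_)]
  · rfl
  · exact absurd (Finset.mem_range.2 (by omega)) h

namespace PhiSystem

variable (P : PhiSystem R A M) (γ : DPStructure R A)

/-- The second component of the `n`-th divided power of `(a, x)`. -/
def dpowSnd (n : ℕ) (a : A) (x : M) : M :=
  conv (γ.divPow a) (fun j => P.phi j x) n

theorem dpowSnd_index_zero (a : A) (x : M) : P.dpowSnd γ 0 a x = 0 := by
  rw [dpowSnd, conv_zero_apply, P.phi_zero, smul_zero]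

theorem dpowSnd_add_right (n : ℕ) (a : A) (x y : M) :
    P.dpowSnd γ n a (x + y) = P.dpowSnd γ n a x + P.dpowSnd γ n a y := by
  have : (fun j => P.phi j (x + y)) = (fun j => P.phi j x) + fun j => P.phi j y := by
    ext j; exact map_add _ _ _
  rw [dpowSnd, this, conv_add]
  rfl

theorem dpowSnd_zero_right (n : ℕ) (a : A) : P.dpowSnd γ n a 0 = 0 := by
  simpa using P.dpowSnd_add_right γ n a 0 0

theorem dpowSnd_neg_right (n : ℕ) (a : A) (x : M) :
    P.dpowSnd γ n a (-x) = -P.dpowSnd γ n a x := by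
  rw [eq_neg_iff_add_eq_zero, ← dpowSnd_add_right, neg_add_cancel, dpowSnd_zero_right]

theorem inr_pow_smul_phi (γ : DPStructure R A) (a : A) {j n : ℕ} (hj : 1 < j) (hn : j ≤ n) (x : M) :
    (a : Unitization R A) ^ n • P.phi j x = 0 :=
  γ.inr_pow_smul_of_chooseKilled a hj hn (P.chooseKilled j x)

/-- All terms except `φ_n x` lie in `A · M`, which `φ_j` kills for `j > 1`. -/
theorem phi_dpowSnd {j : ℕ} (hj : 1 < j) (n : ℕ) (a : A) (x : M) :
    P.phi j (P.dpowSnd γ n a x) = P.phi j (P.phi n x) := by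
  rw [dpowSnd, conv_eq_sum_range, Finset.sum_range_succ, map_add, map_sum, Finset.sum_eq_zero,
    zero_add, Nat.sub_self, DPStructure.divPow_zero, one_smul]
  intro l hl
  have := Finset.mem_range.1 hl
  rw [γ.divPow_of_pos (by omega), P.phi_inr_smul _ hj]

theorem dpowSnd_inr_smul (k : ℕ) (b c : A) (x : M) :
    P.dpowSnd γ (k + 1) c ((b : Unitization R A) • x) =
      γ.divPow c k • (b : Unitization R A) • x := by
  rw [dpowSnd, conv_succ_of_single, P.phi_one]
  intro j hj _
  rcases Nat.eq_zero_or_pos j with rfl | h0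
  · rw [P.phi_zero, smul_zero]
  · rw [P.phi_inr_smul j (by omega), smul_zero]

/-- `a ^ (k + 1)` kills `φ_j x` for `1 < j ≤ k + 1`, so only `j = 1` contributes. -/
theorem inr_pow_smul_dpowSnd (k : ℕ) (a b : A) (x : M) :
    (a : Unitization R A) ^ (k + 1) • P.dpowSnd γ (k + 1) b x =
      ((a : Unitization R A) ^ (k + 1) * γ.divPow b k) • x := by
  have h : (a : Unitization R A) ^ (k + 1) • P.dpowSnd γ (k + 1) b x =
      conv (fun i => (a : Unitization R A) ^ (k + 1) * γ.divPow b i) (fun j => P.phi j x)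
        (k + 1) := by
    rw [dpowSnd, conv, conv, Finset.smul_sum]
    simp only [smul_smul]
  rw [h, conv_eq_sum_range, Finset.sum_eq_single 1]
  · rw [P.phi_one, Nat.add_sub_cancel]
  · intro j hj h1
    have := Finset.mem_range.1 hj
    rcases Nat.eq_zero_or_pos j with rfl | h0
    · rw [P.phi_zero, smul_zero]
    · rw [mul_comm, mul_smul, P.inr_pow_smul_phi γ a (by omega) (by omega), smul_zero]
  · intro hn
    exact absurd (Finset.mem_range.2 (by omega)) hn

/-- The second component of `γ_n(z w) = z ^ n γ_n(w)`: in degrees `j > 1` the operations see neither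
`a y` nor `b x`, and `(k + 1) γ_{k+1}(b) = b γ_k(b)` matches the rest. -/
theorem dpowSnd_mul (k : ℕ) (a b : A) (x y : M) :
    P.dpowSnd γ (k + 1) (a * b) ((a : Unitization R A) • y + (b : Unitization R A) • x) =
      (a : Unitization R A) ^ (k + 1) • P.dpowSnd γ (k + 1) b y +
        ((k + 1) • ((a : Unitization R A) ^ k * γ.divPow b (k + 1))) • x := by
  rw [dpowSnd_add_right, dpowSnd_inr_smul, dpowSnd_inr_smul, inr_pow_smul_dpowSnd,
    γ.divPow_mul_left, ← mul_smul_comm, γ.succ_nsmul_divPow, smul_smul, smul_smul]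
  congr 2 <;> ring

theorem dpowSnd_add {n : ℕ} (hn : 0 < n) (a b : A) (x y : M) :
    P.dpowSnd γ n (a + b) (x + y) = P.dpowSnd γ n a x +
      ∑ i ∈ Finset.Ioo 0 n, (γ.divPow a i • P.dpowSnd γ (n - i) b y +
        γ.divPow b (n - i) • P.dpowSnd γ i a x) + P.dpowSnd γ n b y := by
  have h := sum_antidiagonal_eq_Ioo hn (fun i j => γ.divPow a i • P.dpowSnd γ j b y +
        γ.divPow b j • P.dpowSnd γ i a x)
  simp only [DPStructure.divPow_zero, one_smul, dpowSnd_index_zero, smul_zero, add_zero,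
    zero_add] at h
  rw [Finset.sum_add_distrib, ← Finset.Nat.sum_antidiagonal_swap
    (f := fun z : ℕ × ℕ => γ.divPow b z.2 • P.dpowSnd γ z.1 a x)] at h
  simp only [Prod.fst_swap, Prod.snd_swap] at h
  have h1 : P.dpowSnd γ n (a + b) (x + y) =
      conv (γ.divPow a) (fun j => P.dpowSnd γ j b y) n +
        conv (γ.divPow b) (fun j => P.dpowSnd γ j a x) n := by
    change _ = conv (γ.divPow a) (conv (γ.divPow b) fun j => P.phi j y) n +
      conv (γ.divPow b) (conv (γ.divPow a) fun j => P.phi j x) n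
    rw [dpowSnd_add_right, dpowSnd, dpowSnd, γ.divPow_add, conv_conv, conv_conv,
      conv_comm (γ.divPow b), add_comm]
  rw [h1, conv, conv, h]
  abel

end PhiSystem

end PhiSystem

namespace SqZero

/-- The second component, as an additive map. -/
def sndHom : SqZero R A M →+ M where
  toFun := snd
  map_zero' := rfl
  map_add' _ _ := rfl

theorem snd_sum {ι : Type*} (s : Finset ι) (f : ι → SqZero R A M) :
    (∑ i ∈ s, f i).snd = ∑ i ∈ s, (f i).snd := map_sum sndHom f s

theorem snd_nsmul (n : ℕ) (z : SqZero R A M) : (n • z).snd = n • z.snd := map_nsmul sndHom n z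

theorem fst_sum {ι : Type*} (s : Finset ι) (f : ι → SqZero R A M) :
    (∑ i ∈ s, f i).fst = ∑ i ∈ s, (f i).fst := map_sum (proj R A M) f s

theorem fst_nsmul (n : ℕ) (z : SqZero R A M) : (n • z).fst = n • z.fst :=
  map_nsmul (proj R A M) n z

theorem fst_iterate_mul (z w : SqZero R A M) (n : ℕ) :
    ((fun t => z * t)^[n] w).fst = (fun t => z.fst * t)^[n] w.fst := by
  induction n with
  | zero => rfl
  | succ n ih => rw [Function.iterate_succ_apply', Function.iterate_succ_apply', fst_mul, ih]

theorem snd_iterate_mul (z w : SqZero R A M) (n : ℕ) :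
    ((fun t => z * t)^[n + 1] w).snd = (z.fst : Unitization R A) ^ (n + 1) • w.snd +
      ((n + 1) • ((z.fst : Unitization R A) ^ n * (w.fst : Unitization R A))) • z.snd := by
  induction n with
  | zero => simp
  | succ n ih =>
    rw [Function.iterate_succ_apply', snd_mul, ih, fst_iterate_mul, DPStructure.inr_iterate_mul,
      smul_add, smul_smul, smul_smul, add_assoc, ← add_smul]
    congr 2
    · ring
    · simp only [nsmul_eq_mul]
      push_cast
      ring

end SqZero

namespace PhiSystem

variable (P : PhiSystem R A M) (γ : DPStructure R A)

/-- The DP structure on `A ⊕ M` given by operations `φ n` on `M`. -/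
def toDPStructure : DPStructure R (SqZero R A M) where
  dpow n z := ⟨γ.dpow n z.fst, P.dpowSnd γ n z.fst z.snd⟩
  dpow_index_zero z := SqZero.ext (γ.dpow_index_zero _) (P.dpowSnd_index_zero γ _ _)
  dpow_one z := by
    refine SqZero.ext (γ.dpow_one _) ?_
    change P.dpowSnd γ (0 + 1) _ _ = _
    rw [dpowSnd, conv_succ_of_single, P.phi_one, γ.divPow_zero, one_smul]
    intro j hj hj'
    rw [show j = 0 by omega, P.phi_zero, smul_zero]
  dpow_add n hn z w := by
    ext
    · simp only [SqZero.fst_add, SqZero.fst_sum, SqZero.fst_mul]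
      exact γ.dpow_add n hn _ _
    · simp only [SqZero.snd_add, SqZero.snd_sum, SqZero.snd_mul, SqZero.fst_add]
      rw [P.dpowSnd_add γ hn]
      congr 2
      refine Finset.sum_congr rfl fun i hi => ?_
      rw [Finset.mem_Ioo] at hi
      rw [γ.divPow_of_pos hi.1, γ.divPow_of_pos (by omega)]
  dpow_mul n hn z w := by
    obtain ⟨k, rfl⟩ := Nat.exists_eq_succ_of_ne_zero hn.ne'
    refine SqZero.ext ?_ ?_
    · rw [SqZero.fst_iterate_mul]
      exact γ.dpow_mul _ hn _ _
    · rw [Nat.succ_eq_add_one, SqZero.snd_iterate_mul, ← γ.divPow_of_pos hn]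
      exact P.dpowSnd_mul γ k _ _ _ _
  dpow_smul n hn r z := by
    refine SqZero.ext (γ.dpow_smul n hn _ _) ?_
    simp only [SqZero.fst_smul, SqZero.snd_smul]
    rw [dpowSnd, dpowSnd, conv, conv, Finset.smul_sum]
    refine Finset.sum_congr rfl fun x hx => ?_
    rw [Finset.HasAntidiagonal.mem_antidiagonal] at hx
    rw [γ.divPow_smul, P.phi_inl_smul, smul_smul, smul_smul, mul_right_comm,
      ← Unitization.inl_mul, ← pow_add, hx]
  mul_dpow m n hm hn z := by
    ext
    · rw [SqZero.fst_nsmul]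
      exact γ.mul_dpow m n hm hn _
    · rw [SqZero.snd_nsmul, ← Nat.add_choose, ← Nat.choose_symm_add]
      have := γ.choose_nsmul_conv_divPow z.fst (y := fun j => P.phi j z.snd) (P.phi_zero _)
        (fun l => P.chooseKilled l _) m n
      rw [γ.divPow_of_pos hm, γ.divPow_of_pos hn] at this
      exact this.symm
  dpow_comp m n hm hn z := by
    ext
    · rw [SqZero.fst_nsmul]
      exact γ.dpow_comp m n hm hn _
    · rw [SqZero.snd_nsmul, mul_comm m.factorial, ← Nat.uniformBell_eq_div m hn.ne']
      refine (γ.uniformBell_nsmul_conv_divPow z.fst (y := fun j => P.phi j z.snd)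
        (z := fun j => P.phi j (P.dpowSnd γ n z.fst z.snd)) (P.phi_zero _)
        (fun l => P.chooseKilled l _) hm hn (P.phi_zero _) (P.phi_one _) ?_).symm
      intro j hj _
      rw [P.phi_dpowSnd γ hj, P.phi_phi j n (by omega) hn]

/-- The abelian group object `A ⊕ M → A` given by operations `φ n` on `M`. -/
def toAbelianObject : AbelianObject γ (P.toDPStructure γ) (SqZero.proj R A M) where
  isDPHom_proj _ _ := rfl
  zero :=
    { toFun := fun a => ⟨a, 0⟩
      map_smul' := fun r a => by ext <;> simp
      map_zero' := rfl
      map_add' := fun a b => by ext <;> simp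
      map_mul' := fun a b => by ext <;> simp }
  isDPHom_zero n a := SqZero.ext rfl (P.dpowSnd_zero_right γ n a).symm
  proj_zero _ := rfl
  neg :=
    { toFun := fun z => ⟨z.fst, -z.snd⟩
      map_smul' := fun r a => by ext <;> simp
      map_zero' := by ext <;> simp
      map_add' := fun a b => by ext <;> simp [add_comm]
      map_mul' := fun a b => by ext <;> simp [add_comm] }
  isDPHom_neg n z := SqZero.ext rfl (P.dpowSnd_neg_right γ n _ _).symm
  proj_neg _ := rfl
  add :=
    { toFun := fun z => ⟨z.1.1.fst, z.1.1.snd + z.1.2.snd⟩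
      map_smul' := fun r a => by ext <;> simp
      map_zero' := by ext <;> simp
      map_add' := fun a b => by
        ext
        · simp
        · simp; abel
      map_mul' := fun a b => by
        have ha : a.1.1.fst = a.1.2.fst := a.2
        have hb : b.1.1.fst = b.1.2.fst := b.2
        ext
        · simp
        · simp [ha, hb]; abel }
  isDPHom_add n z := by
    have hz : z.1.1.fst = z.1.2.fst := z.2
    refine SqZero.ext rfl ?_
    change P.dpowSnd γ n z.1.1.fst z.1.1.snd + P.dpowSnd γ n z.1.2.fst z.1.2.snd =
      P.dpowSnd γ n z.1.1.fst (z.1.1.snd + z.1.2.snd)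
    rw [P.dpowSnd_add_right, hz]
  proj_add _ := rfl
  zero_add e := SqZero.ext rfl (zero_add _)
  neg_add_cancel e := SqZero.ext rfl (neg_add_cancel _)
  add_comm e f h := SqZero.ext h (add_comm _ _)
  add_assoc e f g h k := SqZero.ext rfl (add_assoc _ _ _)

/-- The DP `A`-module structure given by operations `φ n` on `M`. -/
def toDPModuleStructure : DPModuleStructure M γ where
  dp := P.toDPStructure γ
  abelian := P.toAbelianObject γ
  zero_apply _ := rfl

end PhiSystem

end

section

/-- Convolution with a series of constant term `1` determines the coefficients recursively. -/
theorem eq_of_conv_eq {S M : Type*} [CommRing S] [AddCommGroup M] [Module S M] {f : ℕ → S}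
    {y z : ℕ → M} {n : ℕ} (hf : f 0 = 1) (h : ∀ j, j < n → y j = z j)
    (hc : conv f y n = conv f z n) : y n = z n := by
  rw [conv_eq_sum_range, conv_eq_sum_range, Finset.sum_range_succ, Finset.sum_range_succ,
    Finset.sum_congr rfl (fun j hj => by rw [h j (Finset.mem_range.1 hj)]), Nat.sub_self, hf,
    one_smul, one_smul] at hc
  exact add_left_cancel hc

theorem conv_congr {S M : Type*} [CommRing S] [AddCommGroup M] [Module S M] (f : ℕ → S)
    {y z : ℕ → M} {n : ℕ} (h : ∀ j, j ≤ n → y j = z j) : conv f y n = conv f z n := by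
  rw [conv_eq_sum_range, conv_eq_sum_range]
  exact Finset.sum_congr rfl fun j hj => by rw [h j (Nat.lt_succ_iff.1 (Finset.mem_range.1 hj))]

theorem Derivation_conv {R S M : Type*} [CommRing R] [CommRing S] [Algebra R S] [AddCommGroup M]
    [Module R M] [Module S M] (D : Derivation R S M) (f g : ℕ → S) :
    (fun n => D (conv f g n)) = conv f (fun n => D (g n)) + conv g (fun n => D (f n)) := by
  ext n
  rw [Pi.add_apply, conv, conv, conv, map_sum, ← Finset.Nat.sum_antidiagonal_swap
    (f := fun x : ℕ × ℕ => g x.1 • D (f x.2)), ← Finset.sum_add_distrib]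
  exact Finset.sum_congr rfl fun x _ => D.leibniz _ _

variable {R : Type u} [CommRing R]
  {A : Type v} [NonUnitalCommRing A] [Module R A] [IsScalarTower R A A] [SMulCommClass R A A]
  {M : Type w} [AddCommGroup M] [Module (Unitization R A) M]

/-! ### Modules twisted by the `n`-th power map. -/

section Twist

/-- The mixed terms of the binomial expansion kill `x`, so `r ↦ r ^ n` acts additively on it, like a
Frobenius map. -/
theorem ChooseKilled.inl_add_pow_smul {n : ℕ} (hn : 0 < n) {x : M} (h : ChooseKilled n x)
    (r s : R) : (Unitization.inl ((r + s) ^ n) : Unitization R A) • x =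
      (Unitization.inl (r ^ n) : Unitization R A) • x +
        (Unitization.inl (s ^ n) : Unitization R A) • x := by
  have key : ∀ i ∈ Finset.Ioo 0 n,
      (Unitization.inl (n.choose i • (r ^ i * s ^ (n - i))) : Unitization R A) • x = 0 := by
    intro i hi
    rw [Finset.mem_Ioo] at hi
    rw [Unitization.inl_smul, smul_assoc, smul_comm, h i hi.1 hi.2, smul_zero]
  rw [(Commute.all r s).add_pow', sum_antidiagonal_eq_Ioo hn (fun i j => n.choose i • (r ^ i * s ^ j)),
    Unitization.inl_add, Unitization.inl_add, add_smul, add_smul]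
  have : (Unitization.inl (∑ i ∈ Finset.Ioo 0 n, n.choose i • (r ^ i * s ^ (n - i))) :
      Unitization R A) • x = 0 := by
    change (Unitization.inlRingHom R (A := A)) _ • x = 0
    rw [map_sum, Finset.sum_smul]
    exact Finset.sum_eq_zero key
  rw [this]
  simp [add_comm]

/-- The elements of `M` killed by the binomial coefficients `n.choose i`, `0 < i < n`, with `A₊`
acting through the ring map `A₊ → R`, `(r, a) ↦ r`, and the `n`-th power map of `R`. -/
def PowTwist (_ : Type u) (_ : Type v) (M : Type w) [AddCommGroup M] (n : ℕ) (_ : 0 < n) : Type w := {x : M // ChooseKilled n x}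

namespace PowTwist

variable {n : ℕ} {hn : 0 < n}

instance : AddCommGroup (PowTwist R A M n hn) :=
  inferInstanceAs (AddCommGroup
    ({ carrier := {x : M | ChooseKilled n x}
       add_mem' := fun ha hb i h1 h2 => by rw [smul_add, ha i h1 h2, hb i h1 h2, add_zero]
       zero_mem' := fun i _ _ => smul_zero _
       neg_mem' := fun ha i h1 h2 => by rw [smul_neg, ha i h1 h2, neg_zero] } : AddSubgroup M))

/-- The inclusion in `M`. -/
def val : PowTwist R A M n hn →+ M where
  toFun x := x.1
  map_zero' := rfl
  map_add' _ _ := rfl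

theorem val_injective : Function.Injective (val : PowTwist R A M n hn → M) := Subtype.val_injective

instance : SMul (Unitization R A) (PowTwist R A M n hn) where
  smul c x := ⟨(Unitization.inl (c.fst ^ n) : Unitization R A) • x.1,
    fun i h1 h2 => by rw [smul_comm, x.2 i h1 h2, smul_zero]⟩

theorem val_smul (c : Unitization R A) (x : PowTwist R A M n hn) :
    (c • x).val = (Unitization.inl (c.fst ^ n) : Unitization R A) • x.val := rfl

instance : Module (Unitization R A) (PowTwist R A M n hn) where
  one_smul x := val_injective (by simp [val_smul])
  mul_smul c d x := val_injective (by simp [val_smul, mul_pow, mul_smul])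
  smul_zero c := val_injective (by simp [val_smul])
  smul_add c x y := val_injective (by simp [val_smul])
  add_smul c d x := val_injective (by
    rw [map_add, val_smul, val_smul, val_smul, Unitization.fst_add]
    exact ChooseKilled.inl_add_pow_smul hn x.2 _ _)
  zero_smul x := val_injective (by simp [val_smul, zero_pow hn.ne'])

instance : Module R (PowTwist R A M n hn) :=
  Module.compHom _ (algebraMap R (Unitization R A))

theorem val_scalar_smul (r : R) (x : PowTwist R A M n hn) :
    (r • x).val = (Unitization.inl (r ^ n) : Unitization R A) • x.val := rfl

instance : IsScalarTower R (Unitization R A) (PowTwist R A M n hn) where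
  smul_assoc r c x := by
    rw [Algebra.smul_def, mul_smul]
    rfl

end PowTwist

end Twist

/-! ### Logarithmic derivatives of divided power series, and the operations `φ n` on `Ω`. -/

section Psi

namespace DPStructure

variable (γ : DPStructure R A)

local notation "𝒟" => KaehlerDifferential.D R (Unitization R A)

/-- The coefficients of the logarithmic derivative of the power series `∑ γ_n(a) t ^ n`. -/
noncomputable def psi (a : A) : ℕ → OmegaCA R A :=
  conv (γ.divPow (-a)) (fun n => 𝒟 (γ.divPow a n))

theorem D_divPow (a : A) : (fun n => 𝒟 (γ.divPow a n)) = conv (γ.divPow a) (γ.psi a) := by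
  rw [psi, conv_conv, conv_comm, γ.divPow_neg_conv, single_conv]

theorem psi_zero (a : A) : γ.psi a 0 = 0 := by
  rw [psi, conv_zero_apply, γ.divPow_zero, γ.divPow_zero, Derivation.map_one_eq_zero, smul_zero]

theorem psi_one (a : A) : γ.psi a 1 = dCA R A a := by
  have h := congrFun (γ.D_divPow a) 1
  change 𝒟 (γ.divPow a 1) = conv _ _ (0 + 1) at h
  rw [conv_succ_of_single, γ.divPow_zero, one_smul, γ.divPow_one] at h
  · exact h.symm
  · intro j hj hj'
    rw [show j = 0 by omega, psi_zero, smul_zero]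

theorem eq_psi_of_conv_eq {a : A} {y : ℕ → OmegaCA R A}
    (h : conv (γ.divPow a) y = fun n => 𝒟 (γ.divPow a n)) : y = γ.psi a := by
  rw [psi, ← h, conv_conv, γ.divPow_neg_conv, single_conv]

/-- Logarithmic derivatives turn products of series into sums. -/
theorem psi_add (a b : A) : γ.psi (a + b) = γ.psi a + γ.psi b := by
  refine (γ.eq_psi_of_conv_eq ?_).symm
  rw [divPow_add, Derivation_conv, γ.D_divPow, γ.D_divPow, conv_add, conv_conv, conv_conv,
    conv_comm (γ.divPow b), add_comm]

theorem psi_smul (r : R) (a : A) (n : ℕ) : γ.psi (r • a) n =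
    (Unitization.inl (r ^ n) : Unitization R A) • γ.psi a n := by
  rw [psi, psi, conv, conv, Finset.smul_sum]
  refine Finset.sum_congr rfl fun x hx => ?_
  rw [Finset.HasAntidiagonal.mem_antidiagonal] at hx
  rw [← smul_neg, γ.divPow_smul, γ.divPow_smul, Derivation.leibniz]
  have : 𝒟 (Unitization.inl (r ^ x.2)) = 0 := (𝒟).map_algebraMap (r ^ x.2)
  rw [this, smul_zero, add_zero, smul_smul, smul_smul, mul_right_comm, ← Unitization.inl_mul,
    ← pow_add, hx]

theorem chooseKilled_psi (a : A) (n : ℕ) : ChooseKilled n (γ.psi a n) := by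
  induction n using Nat.strong_induction_on with
  | _ n ih =>
    intro i hi hin
    obtain ⟨j, rfl⟩ := Nat.exists_eq_add_of_lt hin
    rw [add_assoc] at *
    -- The sequence `ψ` is cut off below degree `n = i + (j + 1)`. The cut-off sequence satisfies
    -- `choose_nsmul_conv_divPow` by induction. Applying `d` to `γ_i γ_{j+1} = n.choose i • γ_n`
    -- gives the same identity for `ψ` itself, and the difference of the two is `n.choose i •
    -- ψ_n(a)`.
    obtain ⟨y, hy⟩ : ∃ y : ℕ → OmegaCA R A, y = fun l => if l < i + (j + 1) then γ.psi a l else 0 :=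
      ⟨_, rfl⟩
    have hlt : ∀ l, l < i + (j + 1) → y l = γ.psi a l := fun l hl => by rw [hy]; exact if_pos hl
    have key := γ.choose_nsmul_conv_divPow a (y := y) (by rw [hlt 0 (by omega), psi_zero]) (by
      intro l
      by_cases hl : l < i + (j + 1)
      · rw [hlt l hl]; exact ih l hl
      · intro _ _ _
        rw [show y l = 0 by rw [hy]; exact if_neg hl, smul_zero]) i (j + 1)
    have hD := fun k => (congrFun (γ.D_divPow a) k).symm
    rw [conv_congr _ (n := j + 1) (fun l hl => hlt l (by omega)),
      conv_congr _ (n := i) (fun l hl => hlt l (by omega)), hD, hD, ← Derivation.leibniz,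
      divPow_mul_divPow, map_nsmul, ← hD, conv_eq_sum_range, conv_eq_sum_range,
      Finset.sum_range_succ, Finset.sum_range_succ _ (i + (j + 1)), Nat.sub_self, divPow_zero,
      one_smul, one_smul, Finset.sum_congr rfl (fun l hl => by
        rw [hlt l (Finset.mem_range.1 hl)]), smul_add, smul_add,
      show y (i + (j + 1)) = 0 by rw [hy]; exact if_neg (lt_irrefl _), smul_zero, add_zero] at key
    exact left_eq_add.1 key

/-- Multiply `d(a ^ j γ_j(b))` by the inverse series, with coefficients `a ^ i γ_i(-b)`. The terms
with `da` add up to a coefficient of positive degree of `γ_t(-b) γ_t(b) = 1`. What remains is `a ^ n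
ψ_n(b)`, which vanishes because `ψ_n(b)` is killed by `n.choose i` for `0 < i < n`. -/
theorem psi_mul (a b : A) {n : ℕ} (hn : 1 < n) : γ.psi (a * b) n = 0 := by
  obtain ⟨k, rfl⟩ := Nat.exists_eq_add_of_lt hn
  rw [show 1 + k + 1 = k + 2 by ring] at *
  have h1 : ∀ j, 𝒟 (γ.divPow (a * b) j) = (a : Unitization R A) ^ j • 𝒟 (γ.divPow b j) +
      (γ.divPow b j * (j • (a : Unitization R A) ^ (j - 1))) • dCA R A a := by
    intro j
    rw [γ.divPow_mul_left, Derivation.leibniz, Derivation.leibniz_pow, mul_smul, smul_assoc]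
    rfl
  have h2 : γ.psi (a * b) (k + 2) = (a : Unitization R A) ^ (k + 2) • γ.psi b (k + 2) +
      ((a : Unitization R A) ^ (k + 1) * (b : Unitization R A) * conv (γ.divPow (-b)) (γ.divPow b) (k + 1)) •
        dCA R A a := by
    have h3 : ∑ x ∈ Finset.HasAntidiagonal.antidiagonal (k + 2), γ.divPow (-(a * b)) x.1 •
        (γ.divPow b x.2 * (x.2 • (a : Unitization R A) ^ (x.2 - 1))) • dCA R A a =
        ((a : Unitization R A) ^ (k + 1) * (b : Unitization R A) * conv (γ.divPow (-b)) (γ.divPow b) (k + 1)) •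
        dCA R A a := by
      rw [Finset.Nat.sum_antidiagonal_succ', zero_smul, mul_zero, zero_smul, smul_zero, zero_add,
        conv, Finset.mul_sum, Finset.sum_smul]
      refine Finset.sum_congr rfl fun x hx => ?_
      rw [Finset.HasAntidiagonal.mem_antidiagonal] at hx
      rw [← mul_neg, γ.divPow_mul_left, mul_smul_comm, ← smul_mul_assoc, γ.succ_nsmul_divPow,
        smul_smul, Nat.add_sub_cancel, smul_eq_mul, ← hx]
      congr 1
      ring
    rw [psi, conv, Finset.sum_congr rfl (fun x _ => by rw [h1, smul_add]), Finset.sum_add_distrib,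
      h3]
    congr 1
    rw [psi, conv, Finset.smul_sum]
    refine Finset.sum_congr rfl fun x hx => ?_
    rw [Finset.HasAntidiagonal.mem_antidiagonal] at hx
    rw [← mul_neg, γ.divPow_mul_left, smul_smul, smul_smul, ← hx]
    congr 1
    ring
  rw [h2, γ.divPow_neg_conv, Pi.single_eq_of_ne (by omega), mul_zero, zero_smul, add_zero]
  exact γ.inr_pow_smul_of_chooseKilled a hn le_rfl (γ.chooseKilled_psi b _)

theorem psi_dpow (a : A) {m n : ℕ} (hm : 1 < m) (hn : 0 < n) :
    γ.psi (γ.dpow n a) m = m.uniformBell n • γ.psi a (m * n) := by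
  induction m using Nat.strong_induction_on with
  | _ m ih =>
    -- The value expected in degree `m` is put in place of the actual one. With the induction
    -- hypothesis below `m`, the composition identity then holds for `z`; the true sequence has the
    -- same convolution in degree `m`, so the two values agree.
    obtain ⟨z, hz⟩ : ∃ z, z = Function.update (γ.psi (γ.dpow n a)) m
      (m.uniformBell n • γ.psi a (m * n)) := ⟨_, rfl⟩
    have hne : ∀ j, j ≠ m → z j = γ.psi (γ.dpow n a) j := fun j hj => by
      rw [hz, Function.update_of_ne hj]
    have hm' : z m = m.uniformBell n • γ.psi a (m * n) := by rw [hz, Function.update_self]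
    have hD := fun b k => congrFun (γ.D_divPow b) k
    rw [← hm']
    refine eq_of_conv_eq (γ.divPow_zero (γ.dpow n a)) (fun j hj => (hne j hj.ne).symm) ?_
    rw [← hD, γ.divPow_dpow a _ hn, map_nsmul, hD]
    refine γ.uniformBell_nsmul_conv_divPow a (γ.psi_zero a) (γ.chooseKilled_psi a) (by omega) hn
      ?_ ?_ ?_
    · rw [hne 0 (by omega), psi_zero]
    · rw [hne 1 (by omega), psi_one, ← hD, γ.divPow_of_pos hn]
      rfl
    · intro j hj hjm
      rcases Nat.eq_or_lt_of_le hjm with rfl | hlt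
      · exact hm'
      · rw [hne j hlt.ne, ih j hlt hj]

/-- `psi · n` as an `R`-linear derivation of `A₊` into the twisted module. -/
noncomputable def psiDerivation {n : ℕ} (hn : 1 < n) :
    Derivation R (Unitization R A) (PowTwist R A (OmegaCA R A) n (by omega)) :=
  Derivation.mk'
    { toFun := fun c => ⟨γ.psi c.snd n, γ.chooseKilled_psi _ n⟩
      map_add' := fun c d => PowTwist.val_injective (congrFun (γ.psi_add c.snd d.snd) n)
      map_smul' := fun r c => PowTwist.val_injective ((γ.psi_smul r c.snd n).trans
        (PowTwist.val_scalar_smul r ⟨γ.psi c.snd n, γ.chooseKilled_psi _ n⟩).symm) }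
    (fun c d => PowTwist.val_injective (by
      rw [map_add, PowTwist.val_smul, PowTwist.val_smul]
      change γ.psi (c * d).snd n = _ • γ.psi d.snd n + _ • γ.psi c.snd n
      rw [Unitization.snd_mul, psi_add, psi_add, Pi.add_apply, Pi.add_apply, γ.psi_mul _ _ hn,
        psi_smul, psi_smul, add_zero]))

/-- The operation `φ n` on the Kähler differentials, `1 < n`, with `φ n (d a) = psi a n`. -/
noncomputable def phiOmega {n : ℕ} (hn : 1 < n) : OmegaCA R A →+ OmegaCA R A :=
  PowTwist.val.comp (γ.psiDerivation hn).liftKaehlerDifferential.toAddMonoidHom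

theorem phiOmega_smul {n : ℕ} (hn : 1 < n) (c : Unitization R A) (x : OmegaCA R A) :
    γ.phiOmega hn (c • x) = (Unitization.inl (c.fst ^ n) : Unitization R A) • γ.phiOmega hn x := by
  change PowTwist.val ((γ.psiDerivation hn).liftKaehlerDifferential (c • x)) = _
  rw [map_smul, PowTwist.val_smul]
  rfl

theorem phiOmega_D {n : ℕ} (hn : 1 < n) (c : Unitization R A) :
    γ.phiOmega hn (𝒟 c) = γ.psi c.snd n := by
  change PowTwist.val ((γ.psiDerivation hn).liftKaehlerDifferential (𝒟 c)) = _
  rw [Derivation.liftKaehlerDifferential_comp_D]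
  rfl

theorem phiOmega_dCA {n : ℕ} (hn : 1 < n) (a : A) :
    γ.phiOmega hn (dCA R A a) = γ.psi a n := γ.phiOmega_D hn _

theorem chooseKilled_phiOmega {n : ℕ} (hn : 1 < n) (x : OmegaCA R A) :
    ChooseKilled n (γ.phiOmega hn x) :=
  ((γ.psiDerivation hn).liftKaehlerDifferential x).2

theorem phiOmega_inr_smul {n : ℕ} (hn : 1 < n) (a : A) (x : OmegaCA R A) :
    γ.phiOmega hn ((a : Unitization R A) • x) = 0 := by
  rw [phiOmega_smul, Unitization.fst_inr, zero_pow (by omega), Unitization.inl_zero, zero_smul]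

/-- `ψ_n(a)` and `d γ_n(a)` differ by an element of `A · Ω`, which `φ_m` kills. Hence `φ_m(ψ_n(a)) =
ψ_m(γ_n a)`. -/
theorem phiOmega_psi {m n : ℕ} (hm : 1 < m) (hn : 1 < n) (a : A) :
    γ.phiOmega hm (γ.psi a n) = m.uniformBell n • γ.psi a (m * n) := by
  rw [← γ.psi_dpow a hm (zero_lt_one.trans hn), ← γ.phiOmega_dCA hm, dCA,
    ← γ.divPow_of_pos (zero_lt_one.trans hn),
    congrFun (γ.D_divPow a) n, conv_eq_sum_range, Finset.sum_range_succ, map_add, map_sum,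
    Finset.sum_eq_zero, zero_add, Nat.sub_self, divPow_zero, one_smul]
  intro l hl
  have := Finset.mem_range.1 hl
  rw [γ.divPow_of_pos (by omega), phiOmega_inr_smul]

theorem phiOmega_phiOmega {m n : ℕ} (hm : 1 < m) (hn : 1 < n) (hmn : 1 < m * n)
    (x : OmegaCA R A) :
    γ.phiOmega hm (γ.phiOmega hn x) = m.uniformBell n • γ.phiOmega hmn x := by
  have hx : x ∈ Submodule.span (Unitization R A) (Set.range 𝒟) := by
    rw [KaehlerDifferential.span_range_derivation]; trivial
  induction hx using Submodule.span_induction with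
  | mem x h =>
    obtain ⟨c, rfl⟩ := h
    rw [phiOmega_D, phiOmega_D, γ.phiOmega_psi hm hn]
  | zero => simp
  | add x y _ _ h1 h2 => rw [map_add, map_add, map_add, h1, h2, smul_add]
  | smul c x _ h =>
    rw [phiOmega_smul, phiOmega_smul, phiOmega_smul, h, Unitization.fst_inl, ← pow_mul, mul_comm n,
      smul_comm]

/-- The operations `φ n` on the Kähler differentials of a DP algebra. -/
noncomputable def phiSystem : PhiSystem R A (OmegaCA R A) where
  phi n := if h : 1 < n then γ.phiOmega h else if n = 1 then AddMonoidHom.id _ else 0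
  phi_zero _ := rfl
  phi_one _ := rfl
  phi_inl_smul n r x := by
    split_ifs with h h1
    · rw [phiOmega_smul, Unitization.fst_inl]
    · rw [h1, pow_one]; rfl
    · exact (smul_zero _).symm
  phi_inr_smul n hn a x := by
    rw [dif_pos hn, phiOmega_inr_smul]
  chooseKilled n x := by
    split_ifs with h
    · exact γ.chooseKilled_phiOmega h x
    all_goals
      intro i h1 h2
      omega
  phi_phi m n hm hn x := by
    rcases Nat.eq_or_lt_of_le hm with rfl | hm
    · rw [Nat.succ_eq_add_one, zero_add, Nat.uniformBell_one_left, one_smul, one_mul]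
      rfl
    rcases Nat.eq_or_lt_of_le hn with rfl | hn
    · rw [Nat.succ_eq_add_one, zero_add, Nat.uniformBell_one_right, one_smul, mul_one]
      rfl
    have hmn : 1 < m * n := Nat.one_lt_mul_iff.2 ⟨by omega, by omega, Or.inl hm⟩
    rw [Nat.succ_eq_add_one, zero_add] at hm hn
    rw [dif_pos hm, dif_pos hn, dif_pos hmn, phiOmega_phiOmega]

theorem phiSystem_phi_dCA (a : A) (n : ℕ) : γ.phiSystem.phi n (dCA R A a) = γ.psi a n := by
  rcases Nat.eq_zero_or_pos n with rfl | hn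
  · rw [psi_zero, γ.phiSystem.phi_zero]
  rcases Nat.eq_or_lt_of_le hn with rfl | hn
  · rw [Nat.succ_eq_add_one, zero_add, psi_one, γ.phiSystem.phi_one]
  · exact (congrFun (congrArg DFunLike.coe (dif_pos hn)) _).trans (γ.phiOmega_dCA hn a)

theorem dCA_dpow {n : ℕ} (hn : 0 < n) (a : A) :
    dCA R A (γ.dpow n a) = γ.phiSystem.dpowSnd γ n a (dCA R A a) := by
  rw [PhiSystem.dpowSnd, funext (γ.phiSystem_phi_dCA a), ← congrFun (γ.D_divPow a) n,
    γ.divPow_of_pos hn]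
  rfl

end DPStructure

end Psi

end

section

variable {R : Type u} [CommRing R]
  {A : Type v} [NonUnitalCommRing A] [Module R A] [IsScalarTower R A A] [SMulCommClass R A A]
  {M : Type w} [AddCommGroup M] [Module (Unitization R A) M]
  {N : Type t} [AddCommGroup N] [Module (Unitization R A) N]

/-! ### Maps out of `Ω` and their compatibility with the operations. -/

section Lift

theorem dCA_add (a b : A) : dCA R A (a + b) = dCA R A a + dCA R A b := by
  rw [dCA, Unitization.inr_add, map_add]
  rfl

theorem dCA_smul (r : R) (a : A) :
    dCA R A (r • a) = (Unitization.inl r : Unitization R A) • dCA R A a := by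
  rw [dCA, Unitization.inr_smul, Derivation.map_smul, ← Unitization.algebraMap_eq_inl,
    algebraMap_smul]
  rfl

theorem dCA_mul (a b : A) : dCA R A (a * b) =
    (a : Unitization R A) • dCA R A b + (b : Unitization R A) • dCA R A a := by
  rw [dCA, Unitization.inr_mul, Derivation.leibniz]
  rfl

theorem D_eq_dCA (c : Unitization R A) :
    KaehlerDifferential.D R (Unitization R A) c = dCA R A c.snd := by
  conv_lhs => rw [← Unitization.inl_fst_add_inr_snd_eq c]
  rw [map_add, ← Unitization.algebraMap_eq_inl, Derivation.map_algebraMap, zero_add]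
  rfl

theorem omega_induction {P : OmegaCA R A → Prop} (zero : P 0) (d : ∀ a, P (dCA R A a))
    (add : ∀ x y, P x → P y → P (x + y)) (smul : ∀ (c : Unitization R A) x, P x → P (c • x)) (x) :
    P x := by
  have hx : x ∈ Submodule.span (Unitization R A)
      (Set.range (KaehlerDifferential.D R (Unitization R A))) := by
    rw [KaehlerDifferential.span_range_derivation]; trivial
  induction hx using Submodule.span_induction with
  | mem x h =>
    obtain ⟨c, rfl⟩ := h
    rw [D_eq_dCA]
    exact d _
  | zero => exact zero
  | add x y _ _ h1 h2 => exact add x y h1 h2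
  | smul c x _ h => exact smul c x h

theorem exists_linearMap_dCA {s : A → N} (hadd : ∀ a b, s (a + b) = s a + s b)
    (hsmul : ∀ (r : R) a, s (r • a) = (Unitization.inl r : Unitization R A) • s a)
    (hmul : ∀ a b, s (a * b) = (a : Unitization R A) • s b + (b : Unitization R A) • s a) :
    ∃ f : OmegaCA R A →ₗ[Unitization R A] N, ∀ a, f (dCA R A a) = s a := by
  let _ : Module R N := Module.compHom N (algebraMap R (Unitization R A))
  have : IsScalarTower R (Unitization R A) N := ⟨fun r c x => by
    rw [Algebra.smul_def, mul_smul]; rfl⟩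
  let D : Derivation R (Unitization R A) N := Derivation.mk'
    { toFun := fun c => s c.snd
      map_add' := fun c d => hadd _ _
      map_smul' := fun r c => hsmul r c.snd }
    (fun c d => by
      change s (c * d).snd = c • s d.snd + d • s c.snd
      conv_rhs => rw [← Unitization.inl_fst_add_inr_snd_eq c, ← Unitization.inl_fst_add_inr_snd_eq d]
      rw [Unitization.snd_mul, hadd, hadd, hsmul, hsmul, hmul, add_smul, add_smul]
      simp only [Unitization.snd_add, Unitization.snd_inl, Unitization.snd_inr, zero_add]
      abel)
  exact ⟨D.liftKaehlerDifferential, fun a => D.liftKaehlerDifferential_comp_D _⟩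

theorem omega_hom_ext {f g : OmegaCA R A →ₗ[Unitization R A] N}
    (h : ∀ a, f (dCA R A a) = g (dCA R A a)) : f = g := by
  ext1 x
  induction x using omega_induction with
  | zero => rw [map_zero, map_zero]
  | d a => exact h a
  | add x y hx hy => rw [map_add, map_add, hx, hy]
  | smul c x hx => rw [map_smul, map_smul, hx]

end Lift

namespace PhiSystem

/-- DP derivations with values in a module with operations `φ n`. -/
structure IsDerivation (P : PhiSystem R A M) (γ : DPStructure R A) (s : A → M) : Prop where
  map_add : ∀ a b, s (a + b) = s a + s b
  map_smul : ∀ (r : R) a, s (r • a) = (Unitization.inl r : Unitization R A) • s a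
  leibniz : ∀ a b, s (a * b) = (a : Unitization R A) • s b + (b : Unitization R A) • s a
  map_dpow : ∀ n, 0 < n → ∀ a, s (γ.dpow n a) = P.dpowSnd γ n a (s a)

theorem phi_smul (P : PhiSystem R A M) {n : ℕ} (hn : 1 < n) (c : Unitization R A) (x : M) :
    P.phi n (c • x) = (Unitization.inl (c.fst ^ n) : Unitization R A) • P.phi n x := by
  conv_lhs => rw [← Unitization.inl_fst_add_inr_snd_eq c]
  rw [add_smul, _root_.map_add, P.phi_inl_smul, P.phi_inr_smul n hn, add_zero]

variable {P : PhiSystem R A (OmegaCA R A)} {Q : PhiSystem R A N} {γ : DPStructure R A}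

/-- On `da` both sides solve the recursion given by the divided power series of `a`. For `n > 1`
both are semilinear along `c ↦ c.fst ^ n`, so they agree on the span of the elements `da`. With `f`
the identity this is uniqueness; in general it is universality. -/
theorem map_phi_of_isDerivation {s : A → N} (hP : P.IsDerivation γ (dCA R A))
    (hQ : Q.IsDerivation γ s) {f : OmegaCA R A →ₗ[Unitization R A] N}
    (hf : ∀ a, f (dCA R A a) = s a) (n : ℕ) (x : OmegaCA R A) :
    f (P.phi n x) = Q.phi n (f x) := by
  have hd : ∀ n a, f (P.phi n (dCA R A a)) = Q.phi n (s a) := by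
    intro n a
    induction n using Nat.strong_induction_on with
    | _ n ih =>
      rcases Nat.eq_zero_or_pos n with rfl | hn
      · rw [P.phi_zero, Q.phi_zero, map_zero]
      · refine eq_of_conv_eq (y := fun j => f (P.phi j (dCA R A a)))
          (z := fun j => Q.phi j (s a)) (γ.divPow_zero a) ih ?_
        refine Eq.trans ?_ (hQ.map_dpow n hn a)
        rw [← hf, hP.map_dpow n hn a, dpowSnd, conv, conv, map_sum]
        exact Finset.sum_congr rfl fun _ _ => (f.map_smul _ _).symm
  rcases Nat.eq_zero_or_pos n with rfl | hn
  · rw [P.phi_zero, Q.phi_zero, map_zero]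
  rcases Nat.eq_or_lt_of_le hn with rfl | hn
  · rw [Nat.succ_eq_add_one, zero_add, P.phi_one, Q.phi_one]
  induction x using omega_induction with
  | zero => simp only [map_zero]
  | d a => rw [hd, hf]
  | add x y hx hy => simp only [_root_.map_add, hx, hy]
  | smul c x hx => rw [P.phi_smul hn, LinearMap.map_smul, LinearMap.map_smul, Q.phi_smul hn, hx]

theorem phi_eq_of_isDerivation {Q : PhiSystem R A (OmegaCA R A)}
    (hP : P.IsDerivation γ (dCA R A)) (hQ : Q.IsDerivation γ (dCA R A)) (n : ℕ)
    (x : OmegaCA R A) : P.phi n x = Q.phi n x :=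
  map_phi_of_isDerivation hP hQ (f := LinearMap.id) (fun _ => rfl) n x

theorem dpowSnd_eq_of_isDerivation {Q : PhiSystem R A (OmegaCA R A)}
    (hP : P.IsDerivation γ (dCA R A)) (hQ : Q.IsDerivation γ (dCA R A)) (n : ℕ) (a : A)
    (x : OmegaCA R A) : P.dpowSnd γ n a x = Q.dpowSnd γ n a x := by
  rw [dpowSnd, dpowSnd, funext fun j => phi_eq_of_isDerivation hP hQ j x]

theorem map_dpowSnd {f : M →ₗ[Unitization R A] N} {P : PhiSystem R A M}
    (hf : ∀ n x, f (P.phi n x) = Q.phi n (f x)) (n : ℕ) (a : A) (x : M) :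
    f (P.dpowSnd γ n a x) = Q.dpowSnd γ n a (f x) := by
  rw [dpowSnd, dpowSnd, conv, conv, map_sum]
  exact Finset.sum_congr rfl fun _ _ => by rw [f.map_smul, hf]

end PhiSystem

theorem DPStructure.isDerivation_dCA (γ : DPStructure R A) :
    γ.phiSystem.IsDerivation γ (dCA R A) where
  map_add := dCA_add
  map_smul := dCA_smul
  leibniz := dCA_mul
  map_dpow _ hn a := γ.dCA_dpow hn a

end

/-! ### From abelian group objects over `A` back to operations `φ n`. -/

section

variable {R : Type u} [CommRing R]
  {A : Type v} [NonUnitalCommRing A] [Module R A] [IsScalarTower R A A] [SMulCommClass R A A]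
  {M : Type w} [AddCommGroup M] [Module (Unitization R A) M]
  {E : Type t} [NonUnitalCommRing E] [Module R E]

/-- `M` is the kernel of `π : E → A`, of square zero, with the `A₊`-module structure that comes from
the section `z` of `π`. -/
structure IsSquareZeroKernel (π : E →ₙₐ[R] A) (z : A →ₙₐ[R] E) (ι : M →+ E) : Prop where
  injective : Function.Injective ι
  proj_apply : ∀ x, π (ι x) = 0
  exists_of_proj : ∀ e, π e = 0 → ∃ x, ι x = e
  inr_smul : ∀ (a : A) x, ι ((a : Unitization R A) • x) = z a * ι x
  inl_smul : ∀ (r : R) x, ι ((Unitization.inl r : Unitization R A) • x) = r • ι x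
  mul_eq_zero : ∀ x y, ι x * ι y = 0

namespace IsSquareZeroKernel

variable {π : E →ₙₐ[R] A} {z : A →ₙₐ[R] E} {ι : M →+ E} {γ : DPStructure R A} {ε : DPStructure R E}

theorem exists_dpow (h : IsSquareZeroKernel π z ι) (hπ : IsDPHom ε γ π) (n : ℕ) (x : M) :
    ∃ y, ι y = ε.dpow n (ι x) :=
  h.exists_of_proj _ (by rw [hπ, h.proj_apply, γ.dpow_zero_right])

/-- The restriction of the `n`-th divided power to `M`. -/
noncomputable def phi (h : IsSquareZeroKernel π z ι) (hπ : IsDPHom ε γ π) (n : ℕ) (x : M) : M :=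
  (h.exists_dpow hπ n x).choose

variable (h : IsSquareZeroKernel π z ι) (hπ : IsDPHom ε γ π)

theorem apply_phi (n : ℕ) (x : M) : ι (h.phi hπ n x) = ε.dpow n (ι x) :=
  (h.exists_dpow hπ n x).choose_spec

theorem phi_add (n : ℕ) (x y : M) : h.phi hπ n (x + y) = h.phi hπ n x + h.phi hπ n y := by
  apply h.injective
  rw [map_add, apply_phi, apply_phi, apply_phi, map_add]
  rcases Nat.eq_zero_or_pos n with rfl | hn
  · simp only [ε.dpow_index_zero, add_zero]
  · rw [ε.dpow_add n hn, Finset.sum_eq_zero, add_zero]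
    intro i _
    rw [← apply_phi h hπ, ← apply_phi h hπ, h.mul_eq_zero]

/-- Products in the kernel vanish, so the rule for `γ_i γ_{n-i}` says that the binomial coefficient
kills `γ_n`. -/
theorem chooseKilled_phi (n : ℕ) (x : M) : ChooseKilled n (h.phi hπ n x) := by
  intro i hi hin
  apply h.injective
  have := ε.mul_dpow i (n - i) hi (by omega) (ι x)
  rw [← apply_phi h hπ, ← apply_phi h hπ, h.mul_eq_zero, Nat.add_sub_cancel' hin.le,
    ← Nat.choose_eq_factorial_div_factorial hin.le, ← apply_phi h hπ, ← map_nsmul] at this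
  rw [← this, map_zero]

theorem iterate_mul (h : IsSquareZeroKernel π z ι) (a : A) (n : ℕ) (x : M) :
    (fun e => z a * e)^[n] (ι x) = ι ((a : Unitization R A) ^ n • x) := by
  induction n with
  | zero => simp
  | succ n ih => rw [Function.iterate_succ_apply', ih, pow_succ', mul_smul, h.inr_smul]

/-- The operations `φ n` on the kernel `M` of `E → A`. -/
noncomputable def phiSystem : PhiSystem R A M where
  phi n := AddMonoidHom.mk' (h.phi hπ n) (h.phi_add hπ n)
  phi_zero x := h.injective ((h.apply_phi hπ 0 x).trans
    ((ε.dpow_index_zero _).trans (map_zero ι).symm))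
  phi_one x := h.injective ((h.apply_phi hπ 1 x).trans (ε.dpow_one _))
  phi_inl_smul n r x := by
    apply h.injective
    change ι (h.phi hπ n _) = ι (_ • h.phi hπ n x)
    rw [h.inl_smul, apply_phi, apply_phi, h.inl_smul]
    rcases Nat.eq_zero_or_pos n with rfl | hn
    · rw [ε.dpow_index_zero, ε.dpow_index_zero, smul_zero]
    · rw [ε.dpow_smul n hn]
  phi_inr_smul n hn a x := by
    apply h.injective
    change ι (h.phi hπ n _) = ι 0
    rw [apply_phi, h.inr_smul, ε.dpow_mul n (by omega),
      ← apply_phi h hπ, h.iterate_mul,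
      γ.inr_pow_smul_of_chooseKilled a hn le_rfl (h.chooseKilled_phi hπ n x)]
  chooseKilled := h.chooseKilled_phi hπ
  phi_phi m n hm hn x := by
    apply h.injective
    change ι (h.phi hπ m (h.phi hπ n x)) = ι (_ • h.phi hπ (m * n) x)
    rw [map_nsmul, apply_phi, apply_phi, apply_phi, ε.dpow_comp m n hm hn, mul_comm m.factorial,
      ← Nat.uniformBell_eq_div m hn.ne']

theorem apply_phiSystem_phi (n : ℕ) (x : M) :
    ι ((h.phiSystem hπ).phi n x) = ε.dpow n (ι x) := h.apply_phi hπ n x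

theorem dpow_add_apply (hz : IsDPHom γ ε z) (n : ℕ) (a : A) (x : M) :
    ε.dpow n (z a + ι x) = z (γ.dpow n a) + ι ((h.phiSystem hπ).dpowSnd γ n a x) := by
  rcases Nat.eq_zero_or_pos n with rfl | hn
  · rw [ε.dpow_index_zero, γ.dpow_index_zero, PhiSystem.dpowSnd_index_zero, map_zero, map_zero,
      add_zero]
  · rw [PhiSystem.dpowSnd, conv,
      sum_antidiagonal_eq_Ioo hn fun i j => γ.divPow a i • (h.phiSystem hπ).phi j x,
      (h.phiSystem hπ).phi_zero, smul_zero, add_zero, γ.divPow_zero, one_smul, map_add, map_sum,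
      apply_phiSystem_phi, ε.dpow_add n hn, ← hz n a, add_assoc, add_comm (Finset.sum _ _)]
    congr 2
    refine Finset.sum_congr rfl fun i hi => ?_
    rw [Finset.mem_Ioo] at hi
    rw [γ.divPow_of_pos hi.1, h.inr_smul, apply_phiSystem_phi, hz]

end IsSquareZeroKernel

namespace AbelianObject

variable {γ : DPStructure R A} {ε : DPStructure R E} {π : E →ₙₐ[R] A}

theorem add_zero' (β : AbelianObject γ ε π) (e : E) :
    β.add ⟨(e, β.zero (π e)), (β.proj_zero _).symm⟩ = e := by
  rw [β.add_comm]
  exact β.zero_add e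

/-- With `0_a` the zero section, `(e, f) = (e, 0_a) + (0_a, f) - (0_a, 0_a)` in the fibre product,
where `a = π e`. As the group law is a ring map, it is forced. -/
theorem add_apply (β : AbelianObject γ ε π) (e f : E) (h : π e = π f) :
    β.add ⟨(e, f), h⟩ = e + f - β.zero (π e) := by
  have hz : π (β.zero (π e)) = π e := β.proj_zero _
  have hs : (⟨(e, f), h⟩ : fibreProd π) = ⟨(e, β.zero (π e)), hz.symm⟩ +
      ⟨(β.zero (π e), f), hz.trans h⟩ - ⟨(β.zero (π e), β.zero (π e)), rfl⟩ := by
    apply Subtype.ext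
    ext <;> simp
  have h1 : β.add ⟨(β.zero (π e), f), hz.trans h⟩ = f := by
    have := β.zero_add f
    simp only [← h] at this
    exact this
  have h2 : β.add ⟨(β.zero (π e), β.zero (π e)), rfl⟩ = β.zero (π e) := by
    have := β.zero_add (β.zero (π e))
    simp only [hz] at this
    exact this
  rw [hs, map_sub, map_add, β.add_zero', h1, h2]

/-- An Eckmann–Hilton argument: `(e, 0) (0, f) = 0` in the fibre product, and the group law maps
this product to `e * f`. -/
theorem mul_eq_zero (β : AbelianObject γ ε π) {e f : E} (he : π e = 0) (hf : π f = 0) :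
    e * f = 0 := by
  have h0 : π (0 : E) = 0 := map_zero π
  have h := map_mul β.add ⟨(e, 0), he.trans h0.symm⟩ ⟨(0, f), h0.trans hf.symm⟩
  have hz : β.zero 0 = 0 := map_zero _
  rw [β.add_apply, β.add_apply, congrArg β.zero he, congrArg β.zero h0, hz, sub_zero, sub_zero,
    add_zero, _root_.zero_add] at h
  rw [← h, show (⟨(e, 0), he.trans h0.symm⟩ * ⟨(0, f), h0.trans hf.symm⟩ : fibreProd π) = 0 from
    Subtype.ext (Prod.ext (mul_zero e) (zero_mul f)), map_zero]

theorem neg_apply (β : AbelianObject γ ε π) (e : E) :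
    β.neg e = β.zero (π e) + β.zero (π e) - e := by
  have h := β.neg_add_cancel e
  rw [β.add_apply, β.proj_neg, sub_eq_iff_eq_add] at h
  rw [← h, add_sub_cancel_right]

theorem eq_of_zero_eq (α β : AbelianObject γ ε π) (h : α.zero = β.zero) : α = β := by
  refine AbelianObject.ext h ?_ ?_
  · ext e
    rw [α.neg_apply, β.neg_apply, h]
  · ext ⟨⟨e, f⟩, hef⟩
    exact (α.add_apply e f hef).trans ((β.add_apply e f hef).trans (by rw [h])).symm

end AbelianObject

namespace DPModuleStructure

variable {γ : DPStructure R A}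

theorem ext_dp {σ τ : DPModuleStructure M γ} (h : σ.dp = τ.dp) : σ = τ := by
  obtain ⟨d, α, hα⟩ := σ
  obtain ⟨d', β, hβ⟩ := τ
  obtain rfl : d = d' := h
  obtain rfl : α = β := α.eq_of_zero_eq β (NonUnitalAlgHom.ext fun a => (hα a).trans (hβ a).symm)
  rfl

variable (R A M) in
/-- The inclusion of `M` in `A ⊕ M`. -/
def inclusion : M →+ SqZero R A M where
  toFun x := ⟨0, x⟩
  map_zero' := rfl
  map_add' x y := by ext <;> simp

theorem isSquareZeroKernel (σ : DPModuleStructure M γ) :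
    IsSquareZeroKernel (SqZero.proj R A M) σ.abelian.zero (inclusion R A M) where
  injective x y h := congrArg SqZero.snd h
  proj_apply x := rfl
  exists_of_proj e he := ⟨e.snd, SqZero.ext (Eq.symm he) rfl⟩
  inr_smul a x := by
    rw [σ.zero_apply]
    ext <;> simp [inclusion]
  inl_smul r x := by ext <;> simp [inclusion]
  mul_eq_zero x y := by ext <;> simp [inclusion]

/-- The operations `φ n` on `M` belonging to a DP `A`-module structure. -/
noncomputable def phiSystem (σ : DPModuleStructure M γ) : PhiSystem R A M :=
  σ.isSquareZeroKernel.phiSystem σ.abelian.isDPHom_proj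

theorem dpow_mk (σ : DPModuleStructure M γ) (n : ℕ) (a : A) (x : M) :
    σ.dp.dpow n ⟨a, x⟩ = ⟨γ.dpow n a, σ.phiSystem.dpowSnd γ n a x⟩ := by
  have h := σ.isSquareZeroKernel.dpow_add_apply σ.abelian.isDPHom_proj σ.abelian.isDPHom_zero n a x
  have hadd : ∀ (b : A) (y : M), σ.abelian.zero b + inclusion R A M y = ⟨b, y⟩ := fun b y => by
    rw [σ.zero_apply]
    ext <;> simp [inclusion]
  rwa [hadd, hadd] at h

theorem IsDPDerivation.isDerivation {σ : DPModuleStructure M γ} {s : A → M}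
    (h : σ.IsDPDerivation s) : σ.phiSystem.IsDerivation γ s := by
  obtain ⟨t, ht, hts⟩ := h
  refine ⟨fun a b => ?_, fun r a => ?_, fun a b => ?_, fun n _ a => ?_⟩
  · have := congrArg SqZero.snd (map_add t a b)
    simpa only [hts, SqZero.snd_add] using this
  · have := congrArg SqZero.snd (map_smul t r a)
    simpa only [hts, SqZero.snd_smul] using this
  · have := congrArg SqZero.snd (map_mul t a b)
    simpa only [hts, SqZero.snd_mul] using this
  · have := congrArg SqZero.snd (ht n a)
    simpa only [hts, dpow_mk] using this

theorem eq_of_isDPDerivation_dCA {σ τ : DPModuleStructure (OmegaCA R A) γ}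
    (hσ : σ.IsDPDerivation (dCA R A)) (hτ : τ.IsDPDerivation (dCA R A)) : σ = τ := by
  refine ext_dp (DPStructure.ext ?_)
  funext n ⟨a, x⟩
  rw [dpow_mk, dpow_mk,
    PhiSystem.dpowSnd_eq_of_isDerivation hσ.isDerivation hτ.isDerivation]

end DPModuleStructure

theorem PhiSystem.IsDerivation.isDPDerivation {P : PhiSystem R A M} {γ : DPStructure R A} {s : A → M}
    (h : P.IsDerivation γ s) : (P.toDPModuleStructure γ).IsDPDerivation s := by
  refine ⟨{ toFun := fun a => ⟨a, s a⟩
            map_smul' := fun r a => SqZero.ext rfl (h.map_smul r a)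
            map_zero' := SqZero.ext rfl (by simpa using h.map_add 0 0)
            map_add' := fun a b => SqZero.ext rfl (h.map_add a b)
            map_mul' := fun a b => SqZero.ext rfl (h.leibniz a b) }, fun n a => ?_, fun a => rfl⟩
  refine SqZero.ext rfl ?_
  rcases Nat.eq_zero_or_pos n with rfl | hn
  · refine Eq.trans ?_ (P.dpowSnd_index_zero γ a (s a)).symm
    change s (γ.dpow 0 a) = 0
    rw [γ.dpow_index_zero]
    simpa using h.map_add 0 0
  · exact h.map_dpow n hn a

/-! ### Universality of `d` among sections of abelian group objects. -/

section Universal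

variable [IsScalarTower R E E] [SMulCommClass R E E]
  {γ : DPStructure R A} {ε : DPStructure R E} {π : E →ₙₐ[R] A}

/-- The action of `A₊` on the kernel of `E → A`, through a section `z` of `E → A`. -/
def kernelAction (π : E →ₙₐ[R] A) (z : A →ₙₐ[R] E) :
    A →ₙₐ[R] Module.End R (LinearMap.ker (π : E →ₗ[R] A)) where
  toFun a :=
    { toFun := fun x => ⟨z a * x.1, by
        have hx : π x.1 = 0 := x.2
        change π (z a * x.1) = 0
        rw [map_mul, hx, mul_zero]⟩
      map_add' := fun x y => Subtype.ext (mul_add _ _ _)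
      map_smul' := fun r x => Subtype.ext (mul_smul_comm _ _ _) }
  map_smul' r a := LinearMap.ext fun x => Subtype.ext (by
    change z (r • a) * x.1 = r • (z a * x.1)
    rw [map_smul, smul_mul_assoc])
  map_zero' := LinearMap.ext fun x => Subtype.ext (by
    change z 0 * x.1 = 0
    rw [map_zero, zero_mul])
  map_add' a b := LinearMap.ext fun x => Subtype.ext (by
    change z (a + b) * x.1 = z a * x.1 + z b * x.1
    rw [map_add, add_mul])
  map_mul' a b := LinearMap.ext fun x => Subtype.ext (by
    change z (a * b) * x.1 = z a * (z b * x.1)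
    rw [map_mul, mul_assoc])

/-- The kernel of `E → A`, with the `A₊`-module structure that comes from a section `z`. -/
def SectionKernel (π : E →ₙₐ[R] A) (_ : A →ₙₐ[R] E) : Type t :=
  LinearMap.ker (π : E →ₗ[R] A)

namespace SectionKernel

variable {z : A →ₙₐ[R] E}

instance : AddCommGroup (SectionKernel π z) :=
  inferInstanceAs (AddCommGroup (LinearMap.ker (π : E →ₗ[R] A)))

instance : Module (Unitization R A) (SectionKernel π z) :=
  letI : Module (Module.End R (LinearMap.ker (π : E →ₗ[R] A))) (SectionKernel π z) :=
    inferInstanceAs (Module (Module.End R (LinearMap.ker (π : E →ₗ[R] A)))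
      (LinearMap.ker (π : E →ₗ[R] A)))
  Module.compHom _ (Unitization.lift (kernelAction π z)).toRingHom

/-- The inclusion in `E`. -/
def val : SectionKernel π z →+ E := (LinearMap.ker (π : E →ₗ[R] A)).subtype.toAddMonoidHom

theorem val_smul (c : Unitization R A) (x : SectionKernel π z) :
    val (c • x) = c.fst • val x + z c.snd * val x := rfl

theorem isSquareZeroKernel (β : AbelianObject γ ε π) :
    IsSquareZeroKernel π β.zero (val : SectionKernel π β.zero →+ E) where
  injective := Subtype.val_injective
  proj_apply x := x.2
  exists_of_proj e he := ⟨⟨e, he⟩, rfl⟩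
  inr_smul a x := by
    rw [val_smul, Unitization.fst_inr, Unitization.snd_inr, zero_smul, zero_add]
  inl_smul r x := by
    rw [val_smul, Unitization.fst_inl, Unitization.snd_inl, map_zero, zero_mul, add_zero]
  mul_eq_zero x y := β.mul_eq_zero x.2 y.2

end SectionKernel

theorem isDerivation_sub_zero (β : AbelianObject γ ε π) {s : A →ₙₐ[R] E} (hs : IsDPHom γ ε s)
    {ι : M →+ E} (h : IsSquareZeroKernel π β.zero ι) {d : A → M}
    (hd : ∀ a, ι (d a) = s a - β.zero a) :
    (h.phiSystem β.isDPHom_proj).IsDerivation γ d := by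
  have hs' : ∀ a, s a = β.zero a + ι (d a) := fun a => by rw [hd, add_sub_cancel]
  refine ⟨fun a b => h.injective ?_, fun r a => h.injective ?_, fun a b => h.injective ?_,
    fun n _ a => h.injective ?_⟩
  · rw [map_add, hd, hd, hd, map_add, map_add]
    abel
  · rw [h.inl_smul, hd, hd, map_smul, map_smul, smul_sub]
  · rw [map_add, h.inr_smul, h.inr_smul, hd (a * b), map_mul, map_mul, hs', hs', mul_add, add_mul,
      add_mul, h.mul_eq_zero, mul_comm (ι (d a))]
    abel
  · rw [hd, hs, hs', h.dpow_add_apply β.isDPHom_proj β.isDPHom_zero, add_sub_cancel_left]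

/-- The difference of the section and the zero section is a derivation into the kernel and lifts to
a linear map `f` on `Ω`. The homomorphism sought is `(a, x) ↦ 0_a + f x`. -/
theorem DPModuleStructure.isUniversal_dCA {σ : DPModuleStructure (OmegaCA R A) γ}
    (hσ : σ.IsDPDerivation (dCA R A)) : IsUniversal.{u, v, max u v, t} σ (dCA R A) := by
  intro E _ _ _ _ ε π β s hs hπs
  have hker := SectionKernel.isSquareZeroKernel β
  obtain ⟨ι, hι⟩ : ∃ ι, ι = (SectionKernel.val : SectionKernel π β.zero →+ E) := ⟨_, rfl⟩
  rw [← hι] at hker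
  have hd : ∀ a, ∃ x, ι x = s a - β.zero a := fun a =>
    hker.exists_of_proj _ (by rw [map_sub, hπs, β.proj_zero, sub_self])
  choose d hd using hd
  have hder := isDerivation_sub_zero β hs hker hd
  obtain ⟨f, hf⟩ := exists_linearMap_dCA hder.map_add hder.map_smul hder.leibniz
  have hfphi := PhiSystem.map_phi_of_isDerivation hσ.isDerivation hder hf
  have hmul : ∀ a (x : OmegaCA R A), β.zero a * ι (f x) = ι (f ((a : Unitization R A) • x)) :=
    fun a x => by rw [map_smul, hker.inr_smul]
  let F : SqZero R A (OmegaCA R A) →ₙₐ[R] E :=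
    { toFun := fun z => β.zero z.fst + ι (f z.snd)
      map_smul' := fun r z => by
        rw [SqZero.fst_smul, SqZero.snd_smul, map_smul, map_smul, hker.inl_smul, ← smul_add]
        rfl
      map_zero' := by simp
      map_add' := fun z w => by
        simp only [SqZero.fst_add, SqZero.snd_add, map_add]
        abel
      map_mul' := fun z w => by
        rw [SqZero.fst_mul, SqZero.snd_mul, map_mul, map_add, map_add, mul_add, add_mul, add_mul,
          hker.mul_eq_zero, add_zero, mul_comm (ι _), hmul, hmul]
        abel }
  have hF : ∀ a x, F ⟨a, x⟩ = β.zero a + ι (f x) := fun _ _ => rfl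
  have hproj : ∀ z, π (F z) = SqZero.proj R A _ z := fun z => by
    rw [hF z.fst z.snd, map_add, β.proj_zero, hker.proj_apply, add_zero]
    rfl
  refine ⟨F, ⟨⟨fun n z => ?_, hproj, fun e e' h => ?_⟩, fun a => ?_⟩, ?_⟩
  · obtain ⟨a, x⟩ := z
    rw [σ.dpow_mk, hF, hF, hker.dpow_add_apply β.isDPHom_proj β.isDPHom_zero,
      PhiSystem.map_dpowSnd hfphi]
  · have h0 : ∀ a, F ⟨a, 0⟩ = β.zero a := fun a => by rw [hF, map_zero, map_zero, add_zero]
    rw [σ.abelian.add_apply, β.add_apply, hproj, map_sub, map_add, σ.zero_apply, h0]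
  · rw [hF, hf, hd, add_sub_cancel]
  · rintro G ⟨hG, hGs⟩
    -- A homomorphism preserves neutral elements: apply it to the sum of the zero element of a fibre
    -- with itself.
    have hG0 : ∀ a, G ⟨a, 0⟩ = β.zero a := fun a => by
      have h1 := hG.map_add ⟨a, 0⟩ ⟨a, 0⟩ rfl
      rw [σ.abelian.add_apply, β.add_apply, σ.zero_apply, hG.proj_apply, map_sub, map_add] at h1
      exact sub_right_injective h1
    have hGadd : ∀ a x, G ⟨a, x⟩ = β.zero a + G ⟨0, x⟩ := fun a x => by
      rw [← hG0, ← map_add]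
      congr 1
      ext <;> simp
    have key : ∀ x, G ⟨0, x⟩ = ι (f x) := by
      intro x
      induction x using omega_induction with
      | zero => rw [map_zero, map_zero]; exact map_zero G
      | d a => rw [hf, hd, ← hGs, hGadd a, add_sub_cancel_left]
      | add x y hx hy =>
        rw [map_add, map_add, ← hx, ← hy, ← map_add]
        congr 1
        ext <;> simp
      | smul c x hx =>
        -- The `A₊`-action on the kernel is written in terms of scalars and of products with the
        -- zero section, both of which `G` respects.
        have hc : (⟨0, c • x⟩ : SqZero R A (OmegaCA R A)) =
            c.fst • ⟨0, x⟩ + ⟨c.snd, 0⟩ * ⟨0, x⟩ := by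
          conv_lhs => rw [← Unitization.inl_fst_add_inr_snd_eq c]
          ext <;> simp [add_smul]
        rw [hc, map_add, map_smul, map_mul, hG0, hx, hmul, ← hker.inl_smul, ← map_smul, ← map_add,
          ← map_add, ← add_smul, Unitization.inl_fst_add_inr_snd_eq]
    ext ⟨a, x⟩
    rw [hGadd, key, hF]

end Universal

end

section

variable {R : Type u} [CommRing R]
  {A : Type v} [NonUnitalCommRing A] [Module R A] [IsScalarTower R A A] [SMulCommClass R A A]

/-! ### The ring `U(A)`: its modules carry operations `φ n`. -/

namespace U

variable (R A) in
/-- The generator `φ_p` of `U(A)`. -/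
noncomputable def phiGen (p : Nat.Primes) : U R A := mk R A (UPre.phi R A p)

theorem induction {P : U R A → Prop} (of : ∀ c, P (ofUnitization R A c))
    (phi : ∀ p, P (phiGen R A p)) (add : ∀ x y, P x → P y → P (x + y))
    (mul : ∀ x y, P x → P y → P (x * y)) (x : U R A) : P x := by
  obtain ⟨x, rfl⟩ := RingQuot.mkRingHom_surjective (URel R A) x
  change P (mk R A x)
  induction x using FreeAlgebra.induction with
  | grade0 n =>
    have := of (algebraMap ℤ _ n)
    rw [eq_intCast, map_intCast] at this
    rwa [eq_intCast, map_intCast]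
  | grade1 i =>
    cases i with
    | inl c => exact of c
    | inr p => exact phi p
  | mul x y hx hy => rw [map_mul]; exact mul _ _ hx hy
  | add x y hx hy => rw [map_add]; exact add _ _ hx hy

theorem prime_nsmul_phiGen (p : Nat.Primes) : (p : ℕ) • phiGen R A p = 0 := by
  have := (RingQuot.mkRingHom_rel (URel.prime_mul_phi (R := R) (A := A) p))
  rw [map_mul, map_natCast, map_zero] at this
  rw [nsmul_eq_mul]
  exact this

theorem phiGen_mul_inl (p : Nat.Primes) (r : R) :
    phiGen R A p * ofUnitization R A (Unitization.inl r) =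
      ofUnitization R A (Unitization.inl (r ^ (p : ℕ))) * phiGen R A p := by
  have := (RingQuot.mkRingHom_rel (URel.phi_mul_scalar (R := R) (A := A) p r))
  rwa [map_mul, map_mul] at this

theorem phiGen_mul_inr (p : Nat.Primes) (a : A) :
    phiGen R A p * ofUnitization R A (a : Unitization R A) = 0 := by
  have := (RingQuot.mkRingHom_rel (URel.phi_mul_ideal (R := R) (A := A) p a))
  rwa [map_mul, map_zero] at this

theorem phi_zero : phi R A 0 = 0 := by
  simp [phi, not_isPrimePow_zero]

theorem phi_one : phi R A 1 = 1 := by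
  simp [phi]

theorem phi_prime_pow {p : ℕ} (hp : p.Prime) (e : ℕ) :
    phi R A (p ^ e) = phiGen R A ⟨p, hp⟩ ^ e := by
  rcases Nat.eq_zero_or_pos e with rfl | he
  · rw [pow_zero, pow_zero, phi_one]
  · have h1 : IsPrimePow (p ^ e) := hp.isPrimePow.pow he.ne'
    have hmin : (p ^ e).minFac = p := hp.pow_minFac he.ne'
    have h2 : (⟨(p ^ e).minFac, Nat.minFac_prime h1.ne_one⟩ : Nat.Primes) = ⟨p, hp⟩ :=
      Subtype.ext hmin
    rw [phi, if_neg h1.ne_one, dif_pos h1, h2, hmin, hp.factorization_pow, Finsupp.single_eq_same]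
    rfl

theorem phi_prime (p : Nat.Primes) : phi R A p = phiGen R A p := by
  have := phi_prime_pow (R := R) (A := A) p.2 1
  rwa [pow_one, pow_one] at this

theorem phi_of_not_isPrimePow {n : ℕ} (h1 : n ≠ 1) (hn : ¬ IsPrimePow n) : phi R A n = 0 := by
  rw [phi, if_neg h1, dif_neg hn]

theorem phi_cases {Q : ℕ → U R A → Prop} (zero : Q 0 0) (one : Q 1 1)
    (other : ∀ n, 1 < n → ¬ IsPrimePow n → Q n 0)
    (pow : ∀ (p : Nat.Primes) (e : ℕ), Q ((p : ℕ) ^ (e + 1)) (phiGen R A p ^ (e + 1))) (n : ℕ) :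
    Q n (phi R A n) := by
  by_cases hn : IsPrimePow n
  · obtain ⟨p, e, hp, he, rfl⟩ := (isPrimePow_nat_iff n).1 hn
    obtain ⟨e, rfl⟩ := Nat.exists_eq_succ_of_ne_zero he.ne'
    rw [phi_prime_pow hp]
    exact pow ⟨p, hp⟩ e
  · rcases Nat.lt_trichotomy n 1 with h | rfl | h
    · obtain rfl : n = 0 := by omega
      rw [phi_zero]
      exact zero
    · rw [phi_one]
      exact one
    · rw [phi_of_not_isPrimePow h.ne' hn]
      exact other n h hn

theorem phi_mul_inl (n : ℕ) (r : R) :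
    phi R A n * ofUnitization R A (Unitization.inl r) =
      ofUnitization R A (Unitization.inl (r ^ n)) * phi R A n := by
  induction n using phi_cases (R := R) (A := A) with
  | zero => rw [zero_mul, mul_zero]
  | one => rw [one_mul, mul_one, pow_one]
  | other n _ _ => rw [zero_mul, mul_zero]
  | pow p e =>
    generalize e + 1 = e
    induction e generalizing r with
    | zero => rw [pow_zero, pow_zero, pow_one, one_mul, mul_one]
    | succ e ih => rw [pow_succ, mul_assoc, phiGen_mul_inl, ← mul_assoc, ih, mul_assoc, ← pow_mul,
        ← pow_succ']

theorem phi_mul_inr {n : ℕ} (hn : 1 < n) (a : A) :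
    phi R A n * ofUnitization R A (a : Unitization R A) = 0 := by
  induction n using phi_cases (R := R) (A := A) with
  | zero => rw [zero_mul]
  | one => omega
  | other n _ _ => rw [zero_mul]
  | pow p e => rw [pow_succ, mul_assoc, phiGen_mul_inr, mul_zero]

theorem chooseKilled_phi (n : ℕ) : ChooseKilled n (phi R A n) := by
  induction n using phi_cases (R := R) (A := A) with
  | zero => exact fun _ _ _ => smul_zero _
  | one => exact fun _ _ _ => by omega
  | other n _ _ => exact fun _ _ _ => smul_zero _
  | pow p e =>
    intro i hi hil
    obtain ⟨c, hc⟩ := p.2.dvd_choose_pow hi.ne' hil.ne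
    rw [hc, mul_comm, mul_smul, pow_succ', ← smul_mul_assoc, prime_nsmul_phiGen, zero_mul,
      smul_zero]

/-- If `m n` is a power of `p`, the uniform Bell number is `1` modulo `p`, and `p` kills `φ_{mn}`.
Otherwise the right side is zero. So is the left: either a factor vanishes, or the product is killed
by two distinct primes. -/
theorem phi_mul_phi {m n : ℕ} (hm : 0 < m) (hn : 0 < n) :
    phi R A m * phi R A n = m.uniformBell n • phi R A (m * n) := by
  rcases Nat.eq_or_lt_of_le hm with rfl | hm
  · rw [Nat.succ_eq_add_one, zero_add, Nat.uniformBell_one_left, one_smul, phi_one, one_mul, one_mul]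
  rcases Nat.eq_or_lt_of_le hn with rfl | hn
  · rw [Nat.succ_eq_add_one, zero_add, Nat.uniformBell_one_right, one_smul, phi_one, mul_one,
      mul_one]
  have hm1 : m ≠ 1 := by omega
  have hn1 : n ≠ 1 := by omega
  by_cases hmn : IsPrimePow (m * n)
  · obtain ⟨p, e, hp, he, hpe⟩ := (isPrimePow_nat_iff _).1 hmn
    obtain ⟨a, _, rfl⟩ := (Nat.dvd_prime_pow hp).1 (hpe ▸ dvd_mul_right m n)
    obtain ⟨b, _, rfl⟩ := (Nat.dvd_prime_pow hp).1 (hpe ▸ dvd_mul_left n (p ^ a))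
    have : Fact p.Prime := ⟨hp⟩
    have hk := chooseKilled_phi (R := R) (A := A) (p ^ e)
    rw [← hpe, nsmul_eq_nsmul_of_zmod (b := 1) (hk.prime_nsmul hp he.ne')
      (by rw [uniformBell_pow_zmod, Nat.cast_one]), one_smul, hpe, ← pow_add, phi_prime_pow hp,
      phi_prime_pow hp, phi_prime_pow hp, ← pow_add]
  · rw [phi_of_not_isPrimePow (fun h => hm1 (Nat.eq_one_of_mul_eq_one_right h)) hmn, smul_zero]
    by_cases h1 : IsPrimePow m
    · by_cases h2 : IsPrimePow n
      · obtain ⟨p, a, hp, ha, rfl⟩ := (isPrimePow_nat_iff _).1 h1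
        obtain ⟨q, b, hq, hb, rfl⟩ := (isPrimePow_nat_iff _).1 h2
        have hpq : p ≠ q := by
          rintro rfl
          rw [← pow_add] at hmn
          exact hmn (hp.isPrimePow.pow (by omega))
        have e1 := (chooseKilled_phi (R := R) (A := A) (p ^ a)).prime_nsmul hp ha.ne'
        have e2 := (chooseKilled_phi (R := R) (A := A) (q ^ b)).prime_nsmul hq hb.ne'
        have d1 : addOrderOf (phi R A (p ^ a) * phi R A (q ^ b)) ∣ p :=
          addOrderOf_dvd_of_nsmul_eq_zero (by rw [← smul_mul_assoc, e1, zero_mul])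
        have d2 : addOrderOf (phi R A (p ^ a) * phi R A (q ^ b)) ∣ q :=
          addOrderOf_dvd_of_nsmul_eq_zero (by rw [← mul_smul_comm, e2, mul_zero])
        have := Nat.dvd_gcd d1 d2
        rw [(Nat.coprime_primes hp hq).2 hpq, Nat.dvd_one] at this
        exact AddMonoid.addOrderOf_eq_one_iff.1 this
      · rw [phi_of_not_isPrimePow hn1 h2, mul_zero]
    · rw [phi_of_not_isPrimePow hm1 h1, zero_mul]

theorem map_smul_of_generators {M : Type w} [AddCommGroup M] {N : Type t} [AddCommGroup N]
    {m : Module (U R A) M} {m' : Module (U R A) N} {f : M →+ N}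
    (hof : ∀ c x, f (ofUnitization R A c • x) = ofUnitization R A c • f x)
    (hphi : ∀ p x, f (phiGen R A p • x) = phiGen R A p • f x) (u : U R A) (x : M) :
    f (u • x) = u • f x := by
  induction u using U.induction generalizing x with
  | of c => exact hof c x
  | phi p => exact hphi p x
  | add u v hu hv => rw [add_smul, add_smul, map_add, hu, hv]
  | mul u v hu hv => rw [mul_smul, mul_smul, hu, hv]

section Modules

variable {M : Type w} [AddCommGroup M] [Module (Unitization R A) M]

/-- The operations `φ n` of a left `U(A)`-module. -/
noncomputable def phiSystem (m : Module (U R A) M) (h : Extends m) : PhiSystem R A M where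
  phi n := AddMonoidHom.mk' (fun x : M => phi R A n • x) (smul_add _)
  phi_zero x := by
    change phi R A 0 • x = 0
    rw [phi_zero, zero_smul]
  phi_one x := by
    change phi R A 1 • x = x
    rw [phi_one, one_smul]
  phi_inl_smul n r x := by
    change phi R A n • (_ : M) = (_ : Unitization R A) • phi R A n • x
    rw [← h, ← h, smul_smul, smul_smul, phi_mul_inl]
  phi_inr_smul n hn a x := by
    change phi R A n • (_ : M) = 0
    rw [← h, smul_smul, phi_mul_inr hn, zero_smul]
  chooseKilled n x i h1 h2 := by
    change n.choose i • phi R A n • x = 0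
    rw [← smul_assoc, chooseKilled_phi n i h1 h2, zero_smul]
  phi_phi k n hk hn x := by
    change phi R A k • phi R A n • x = (_ : ℕ) • phi R A (k * n) • x
    rw [smul_smul, phi_mul_phi hk hn, smul_assoc]

theorem phiSystem_phi (m : Module (U R A) M) (h : Extends m) (n : ℕ) (x : M) :
    (phiSystem m h).phi n x = phi R A n • x := rfl

theorem dpowSnd_eq (γ : DPStructure R A) (m : Module (U R A) M) (h : Extends m) {n : ℕ}
    (hn : 0 < n) (a : A) (x : M) :
    dpowSnd γ n a x = (phiSystem m h).dpowSnd γ n a x := by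
  rw [dpowSnd, PhiSystem.dpowSnd, conv,
    sum_antidiagonal_eq_Ioo hn fun i j => γ.divPow a i • (phiSystem m h).phi j x,
    (phiSystem m h).phi_zero, smul_zero, add_zero, γ.divPow_zero, one_smul]
  congr 1
  refine Finset.sum_congr rfl fun i hi => ?_
  rw [Finset.mem_Ioo] at hi
  rw [h, γ.divPow_of_pos hi.1]
  rfl

theorem isDerivation_phiSystem_iff (γ : DPStructure R A) (m : Module (U R A) M) (h : Extends m)
    {s : A → M} : (phiSystem m h).IsDerivation γ s ↔ IsDPDerivation γ s := by
  constructor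
  · rintro ⟨h1, h2, h3, h4⟩
    refine ⟨h1, fun r a => ?_, fun a b => ?_, fun n hn a => ?_⟩
    · rw [h2, h]
    · rw [h3, h, h]
    · rw [h4 n hn, dpowSnd_eq γ m h hn]
  · rintro ⟨h1, h2, h3, h4⟩
    refine ⟨h1, fun r a => ?_, fun a b => ?_, fun n hn a => ?_⟩
    · rw [h2, h]
    · rw [h3, h, h]
    · rw [h4 n hn, dpowSnd_eq γ m h hn]

end Modules

end U

/-! ### Conversely, operations `φ n` define a `U(A)`-module. -/

namespace PhiSystem

variable {M : Type w} [AddCommGroup M] [Module (Unitization R A) M] (P : PhiSystem R A M)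

theorem prime_nsmul_phi {p : ℕ} (hp : p.Prime) (x : M) : p • P.phi p x = 0 := by
  have h := P.chooseKilled (p ^ 1) x
  have := h.prime_nsmul hp one_ne_zero
  rwa [pow_one] at this

/-- The action of the free ring on `M`. -/
noncomputable def preAction : UPre R A →+* AddMonoid.End M :=
  (FreeAlgebra.lift ℤ (Sum.elim (fun c => (Module.toAddMonoidEnd (Unitization R A) M c))
    (fun p : Nat.Primes => (P.phi p : AddMonoid.End M)))).toRingHom

theorem preAction_of (c : Unitization R A) (x : M) : P.preAction (UPre.of c) x = c • x :=
  DFunLike.congr_fun (FreeAlgebra.lift_ι_apply (R := ℤ) (A := AddMonoid.End M) _ (Sum.inl c)) x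

theorem preAction_phi (p : Nat.Primes) (x : M) :
    P.preAction (UPre.phi R A p) x = P.phi p x :=
  DFunLike.congr_fun (FreeAlgebra.lift_ι_apply (R := ℤ) (A := AddMonoid.End M) _ (Sum.inr p)) x

theorem preAction_mul (u v : UPre R A) (x : M) :
    P.preAction (u * v) x = P.preAction u (P.preAction v x) := by
  rw [map_mul]; rfl

theorem preAction_rel {x y : UPre R A} (h : URel R A x y) : P.preAction x = P.preAction y := by
  ext m
  cases h with
  | one => rw [preAction_of, map_one, one_smul]; rfl
  | add c d =>
    rw [preAction_of, _root_.map_add, add_smul, ← P.preAction_of c, ← P.preAction_of d]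
    rfl
  | mul c d => rw [preAction_of, preAction_mul, preAction_of, preAction_of, mul_smul]
  | prime_mul_phi p =>
    rw [preAction_mul, map_natCast, map_zero, preAction_phi]
    exact P.prime_nsmul_phi p.2 m
  | phi_mul_scalar p r =>
    rw [preAction_mul, preAction_mul, preAction_of, preAction_of, preAction_phi, preAction_phi,
      P.phi_inl_smul]
  | phi_mul_ideal p a =>
    rw [preAction_mul, map_zero, preAction_of, preAction_phi, P.phi_inr_smul _ p.2.one_lt]
    rfl

/-- The left `U(A)`-module given by operations `φ n`. -/
@[reducible] noncomputable def toModule : Module (U R A) M :=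
  Module.compHom M (RingQuot.lift ⟨P.preAction, fun _ _ h => P.preAction_rel h⟩ :
    U R A →+* AddMonoid.End M)

theorem toModule_mk_smul (z : UPre R A) (x : M) :
    (letI := P.toModule; U.mk R A z • x) = P.preAction z x := by
  change (RingQuot.lift ⟨P.preAction, fun _ _ h => P.preAction_rel h⟩ (RingQuot.mkRingHom _ z)) x = _
  rw [RingQuot.lift_mkRingHom_apply]

theorem extends_toModule : U.Extends P.toModule := fun c x =>
  (P.toModule_mk_smul _ x).trans (P.preAction_of c x)

/-- The composition rule has coefficient `1` here, since `p.uniformBell (p ^ e)` is `1` modulo `p`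
and `p` kills the values of `φ_{p^(e+1)}`. -/
theorem phi_prime_pow {p : ℕ} (hp : p.Prime) (e : ℕ) (x : M) :
    P.phi (p ^ e) x = (P.phi p)^[e] x := by
  have : Fact p.Prime := ⟨hp⟩
  induction e with
  | zero => rw [pow_zero, P.phi_one]; rfl
  | succ e ih =>
    rw [Function.iterate_succ_apply', ← ih, P.phi_phi _ _ hp.pos (pow_pos hp.pos e), ← pow_succ',
      nsmul_eq_nsmul_of_zmod (b := 1) ((P.chooseKilled _ _).prime_nsmul hp e.succ_ne_zero)
      (by rw [uniformBell_pow_zmod, Nat.cast_one]), one_smul]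

/-- The module is built from the `φ_p` alone; the other operations are recovered because they are
iterates of `φ_p` at prime powers, and vanish at other `n > 1`, where the middle binomial
coefficients have gcd `1`. -/
theorem toModule_phi_smul (n : ℕ) (x : M) : (letI := P.toModule; U.phi R A n • x) = P.phi n x := by
  let _ := P.toModule
  change U.phi R A n • x = P.phi n x
  induction n using U.phi_cases (R := R) (A := A) with
  | zero => rw [P.phi_zero, zero_smul]
  | one => rw [P.phi_one, one_smul]
  | other n h1 hn => rw [(P.chooseKilled n x).eq_zero h1 hn, zero_smul]
  | pow p e =>
    rw [P.phi_prime_pow p.2]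
    generalize e + 1 = e
    induction e with
    | zero => rw [pow_zero, one_smul]; rfl
    | succ e ih =>
      rw [pow_succ', mul_smul, ih, Function.iterate_succ_apply']
      exact (P.toModule_mk_smul _ _).trans (P.preAction_phi p _)

theorem IsDerivation.toModule {P : PhiSystem R A M} {γ : DPStructure R A} {s : A → M}
    (h : P.IsDerivation γ s) : letI := P.toModule; U.IsDPDerivation γ s := by
  refine (U.isDerivation_phiSystem_iff γ P.toModule P.extends_toModule).1
    ⟨h.map_add, h.map_smul, h.leibniz, fun n hn a => ?_⟩
  rw [h.map_dpow n hn, dpowSnd, dpowSnd]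
  congr 1
  ext j
  exact (P.toModule_phi_smul j _).symm

end PhiSystem

/-! ### Uniqueness and universality in terms of `U(A)`-modules. -/

namespace U

variable {γ : DPStructure R A}

theorem module_eq_of_isDPDerivation {m m' : Module (U R A) (OmegaCA R A)} (h : Extends m)
    (h' : Extends m') (hd : letI := m; IsDPDerivation γ (dCA R A))
    (hd' : letI := m'; IsDPDerivation γ (dCA R A)) : m = m' := by
  refine Module.ext' _ _ fun u x => ?_
  refine map_smul_of_generators (m := m) (m' := m') (f := AddMonoidHom.id _) (fun c x => ?_)
    (fun p x => ?_) u x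
  · exact (h c x).trans (h' c x).symm
  · have := PhiSystem.phi_eq_of_isDerivation ((isDerivation_phiSystem_iff γ m h).2 hd)
      ((isDerivation_phiSystem_iff γ m' h').2 hd') p x
    rwa [phiSystem_phi, phiSystem_phi, phi_prime] at this

theorem isUniversal_dCA {m : Module (U R A) (OmegaCA R A)} (h : Extends m)
    (hd : IsDPDerivation γ (dCA R A)) : IsUniversal.{u, v, max u v, t} γ (dCA R A) := by
  intro N _ mN s hs
  let _ : Module (Unitization R A) N := Module.compHom N (ofUnitization R A)
  have hN : Extends mN := fun _ _ => rfl
  have hs' := (isDerivation_phiSystem_iff γ mN hN).2 hs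
  obtain ⟨f, hf⟩ := exists_linearMap_dCA hs'.map_add hs'.map_smul hs'.leibniz
  have hphi := PhiSystem.map_phi_of_isDerivation ((isDerivation_phiSystem_iff γ m h).2 hd) hs' hf
  have hlin := map_smul_of_generators (m := m) (m' := mN) (f := f.toAddMonoidHom)
    (fun c x => by
      rw [h, hN]
      exact f.map_smul c x)
    (fun p x => by
      rw [← phi_prime]
      exact hphi p x)
  refine ⟨⟨f.toAddHom, hlin⟩, hf, fun g hg => ?_⟩
  let g' : OmegaCA R A →ₗ[Unitization R A] N := ⟨g.toAddHom, fun c x => by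
    change g (c • x) = c • g x
    rw [← h, ← hN, map_smul]⟩
  have : g' = f := omega_hom_ext fun a => (hg a).trans (hf a).symm
  ext x
  exact LinearMap.congr_fun this x

end U

end

end DPKaehler

theorem mainTheorem1 {R : Type u} [CommRing R]
    {A : Type v} [NonUnitalCommRing A] [Module R A] [IsScalarTower R A A] [SMulCommClass R A A]
    (γ : DPKaehler.DPStructure R A) :
    (∃! σ : DPKaehler.DPModuleStructure (DPKaehler.OmegaCA R A) γ,
      σ.IsDPDerivation (DPKaehler.dCA R A)) ∧
    (∀ σ : DPKaehler.DPModuleStructure (DPKaehler.OmegaCA R A) γ,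
      σ.IsDPDerivation (DPKaehler.dCA R A) → DPKaehler.DPModuleStructure.IsUniversal.{u, v, max u v, w} σ (DPKaehler.dCA R A)) ∧
    (∃! m : Module (DPKaehler.U R A) (DPKaehler.OmegaCA R A),
      DPKaehler.U.Extends m ∧ DPKaehler.U.IsDPDerivation γ (DPKaehler.dCA R A)) ∧
    (∀ m : Module (DPKaehler.U R A) (DPKaehler.OmegaCA R A),
      DPKaehler.U.Extends m → DPKaehler.U.IsDPDerivation γ (DPKaehler.dCA R A) →
        DPKaehler.U.IsUniversal.{u, v, max u v, w} γ (DPKaehler.dCA R A) ∧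
        ∀ σ : DPKaehler.DPModuleStructure (DPKaehler.OmegaCA R A) γ,
          σ.IsDPDerivation (DPKaehler.dCA R A) →
            ∀ n, 0 < n → ∀ (a : A) (x : DPKaehler.OmegaCA R A),
              σ.dp.dpow n ⟨a, x⟩ = ⟨γ.dpow n a, DPKaehler.U.dpowSnd γ n a x⟩) := by
  refine ⟨⟨γ.phiSystem.toDPModuleStructure γ, γ.isDerivation_dCA.isDPDerivation,
    fun σ hσ => DPKaehler.DPModuleStructure.eq_of_isDPDerivation_dCA hσ
      γ.isDerivation_dCA.isDPDerivation⟩,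
    fun σ hσ => DPKaehler.DPModuleStructure.isUniversal_dCA hσ,
    ⟨γ.phiSystem.toModule, ⟨γ.phiSystem.extends_toModule, γ.isDerivation_dCA.toModule⟩,
      fun m hm => DPKaehler.U.module_eq_of_isDPDerivation hm.1 γ.phiSystem.extends_toModule hm.2
        γ.isDerivation_dCA.toModule⟩,
    fun m hm hd => ⟨DPKaehler.U.isUniversal_dCA hm hd, fun σ hσ n hn a x => ?_⟩⟩
  -- Both structures come from operations on `Ω` for which `d` is a derivation, and such operations
  -- are unique.
  rw [σ.dpow_mk, DPKaehler.U.dpowSnd_eq γ m hm hn,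
    DPKaehler.PhiSystem.dpowSnd_eq_of_isDerivation hσ.isDerivation
      ((DPKaehler.U.isDerivation_phiSystem_iff γ m hm).2 hd)]
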